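/- **Lemma (Structure preserving model reduction).** *Network.* Let $(\mathcal V,\mathcal E)$ be a finite connected directed graph without loops. Each edge $e$ is identified with $[0,\ell^e]$, $\ell^e>0$, and carries constants $a^e,b^e,d^e>0$. Let $\mathcal V_\partial\subset\mathcal V$ be a nonempty set of vertices (ports), each incident to exactly one edge, and $\mathcal V_0=\mathcal V\setminus\mathcal V_\partial$. Let $\mathcal E(v)$ be the set of edges incident to $v$, let $n^e(v)=-1$ if $e$ starts at $v$ and $n^e(v)=1$ if $e$ ends at $v$, and let $[nq](v)=\sum_{e\in\mathcal E(v)}n^e(v)q^e(v)$; at a port $v$ this is the single term $n^e(v)q^e(v)$. Let $L^2(\mathcal E)=\prod_eL^2(0,\ell^e)$ with inner product $(\cdot,\cdot)_{\mathcal E}$, let $H^1(\mathcal E)=\prod_eH^1(0,\ell^e)$, and let $\partial_x'$ be the edgewise derivative. Put $E(p,q)=\frac12\sum_e\int_e a^e|p^e|^2+b^e|q^e|^2\,dx$. *Continuous problem.* For inputs $u(t)\in\mathbb R^{\mathcal V_\partial}$ a classical solution on $[0,T]$ is a pair $p,q\in C^1([0,T];L^2(\mathcal E))\cap C([0,T];H^1(\mathcal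 E))$ with $a^e\partial_tp^e+\partial_xq^e=0$ and $b^e\partial_tq^e+\partial_xp^e+d^eq^e=0$ on every edge, $[nq](v)=0$ and $p^e(v)=p^{e'}(v)$ for all $v\in\mathcal V_0$, $e,e'\in\mathcal E(v)$, and $p^e(v)=u_v$ for $v\in\mathcal V_\partial$. *Galerkin system.* For subspaces $P\subset L^2(\mathcal E)$, $Q\subset H^1(\mathcal E)$ of finite dimension and $p_0,q_0\in L^2(\mathcal E)$, a solution on $[0,T]$ consists of $p\in H^1(0,T;P)$, $q\in H^1(0,T;Q)$, $\lambda\in L^2(0,T;\mathbb R^{\mathcal V_0})$ such that $p(0)$, $q(0)$ have the same $L^2(\mathcal E)$ inner products with all elements of $P$, respectively $Q$, as $p_0$, $q_0$, such that $[nq(t)]=0$ on $\mathcal V_0$ for all $t\in[0,T]$, and such that for a.e. $t$ and all $\tilde p\in P$, $\tilde q\in Q$ $$(a\partial_tp,\tilde p)_{\mathcal E}+(\partial_x'q,\tilde p)_{\mathcal E}=0,$$ $$(b\partial_tq,\tilde q)_{\mathcal E}-(p,\partial_x'\tilde q)_{\mathcal E}+(dq,\tilde q)_{\mathcal E}+\sum_{v\in\mathcal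 V_0}\lambda_v[n\tilde q](v)=-\sum_{v\in\mathcal V_\partial}u_v\,[n\tilde q](v).$$ The output is $y_v=-[nq](v)$, $v\in\mathcal V_\partial$. The stationary system for $\bar u\in\mathbb R^{\mathcal V_\partial}$ is obtained by taking $u=\bar u$ and dropping time derivatives and initial conditions. *Claim.* There are constants $C,\gamma>0$, depending only on the network and the coefficients, such that: (i) for every classical solution of the continuous problem whose input vanishes on $[t_1,t_2]\subset[0,T]$, $E(p(t),q(t))\le Ce^{-\gamma(t-s)}E(p(s),q(s))$ for all $t_1\le s\le t\le t_2$; (ii) for all finite-dimensional $P_h\subset L^2(\mathcal E)$, $Q_h\subset H^1(\mathcal E)$ and all subspaces $P_H\subset P_h$, $Q_H\subset Q_h$ with (A1$_H$) $1\in P_H$, (A2$_H$) $\partial_x'Q_H=P_H$, (A3$_H$) $1^e\in Q_H$ for every $e\in\mathcal E$ (the function equal to $1$ on $e$ and $0$ on all other edges), the reduced system, i.e. the Galerkin system with $P=P_H$, $Q=Q_H$, satisfies - (P1) every solution satisfies $\frac{d}{dt}\sum_e\int_ea^ep^e\,dx=\sum_{v\in\mathcal V_\partial}y_v$ on $[0,T]$;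 - (P2) along every solution the energy is absolutely continuous and $\frac{d}{dt}E(p,q)=-\sum_e\int_ed^e|q^e|^2dx+\sum_{v\in\mathcal V_\partial}y_vu_v$ for a.e. $t$, and for all $t\in[0,T]$ if $u$ is continuous; - (P3) for every solution whose input vanishes on $[t_1,t_2]\subset[0,T]$, $E(p(t),q(t))\le Ce^{-\gamma(t-s)}E(p(s),q(s))$ for $t_1\le s\le t\le t_2$, with the same $C,\gamma$ as in (i); - (P4) for every $\bar u$ the stationary system has a unique solution $(\bar p,\bar q,\bar\lambda)$, and if $(p,q,\lambda)$ is a solution on $[0,T]$ for every $T>0$ and $u(t)=\bar u$ for all $t\ge t_0\ge 0$, then $p(t)\to\bar p$ and $q(t)\to\bar q$ as $t\to\infty$, with $E(p(t)-\bar p,q(t)-\bar q)\le Ce^{-\gamma(t-s)}E(p(s)-\bar p,q(s)-\bar q)$ for $t_0\le s\le t$. -/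

import Mathlib

open MeasureTheory Set Filter Topology

/-- A finite connected directed graph of pipes.  The pipe `e` runs from `tail e` to `head e` and is
identified with the interval `[0, len e]`; it carries positive constant coefficients `a e`, `b e`,
`d e`.  The nonempty set `ports` is the set of boundary vertices; each of them is incident to
exactly one pipe.  All other vertices are the inner vertices.  Parallel pipes are allowed. -/
structure Network (V E : Type*) [Fintype V] [DecidableEq V] [Fintype E] where
  tail : E → V
  head : E → V
  tail_ne_head : ∀ e, tail e ≠ head e
  connected : (SimpleGraph.fromRel fun v w => ∃ e, tail e = v ∧ head e = w).Connected
  ports : Finset V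
  ports_nonempty : ports.Nonempty
  port_unique : ∀ v ∈ ports, ∃! e, tail e = v ∨ head e = v
  len : E → ℝ
  a : E → ℝ
  b : E → ℝ
  d : E → ℝ
  len_pos : ∀ e, 0 < len e
  a_pos : ∀ e, 0 < a e
  b_pos : ∀ e, 0 < b e
  d_pos : ∀ e, 0 < d e

namespace Network

variable {V E : Type*} [Fintype V] [DecidableEq V] [Fintype E] (N : Network V E)

/-- Boundary vertices. -/
abbrev Port : Type _ := {v : V // v ∈ N.ports}

/-- Inner vertices. -/
abbrev Inner : Type _ := {v : V // v ∉ N.ports}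

/-- Square integrable functions on the network, with the Hilbert space structure
`(p, p')_E = ∑ₑ ∫ₑ pᵉ p'ᵉ dx`. -/
abbrev L2 : Type _ :=
  PiLp 2 fun e : E => Lp ℝ 2 (volume.restrict (Icc (0 : ℝ) (N.len e)))

/-- The weighted product `∑ₑ wᵉ ∫ₑ fᵉ gᵉ dx`. -/
noncomputable def wip (w : E → ℝ) (f g : N.L2) : ℝ :=
  ∑ e, w e * inner ℝ (f e) (g e)

/-- Total mass `∑ₑ ∫ₑ aᵉ pᵉ dx`. -/
noncomputable def mass (p : N.L2) : ℝ :=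
  ∑ e, ∫ x in (0 : ℝ)..N.len e, N.a e * p e x

/-- Total energy `1/2 ∑ₑ ∫ₑ aᵉ |pᵉ|² + bᵉ |qᵉ|² dx`. -/
noncomputable def energy (p q : N.L2) : ℝ :=
  (1 / 2) * (N.wip N.a p p + N.wip N.b q q)

/-- The start point of a pipe. -/
def start (e : E) : Icc (0 : ℝ) (N.len e) := ⟨0, le_rfl, (N.len_pos e).le⟩

/-- The end point of a pipe. -/
def finish (e : E) : Icc (0 : ℝ) (N.len e) := ⟨N.len e, (N.len_pos e).le, le_rfl⟩

theorem intervalIntegrable_L2 (g : N.L2) (e : E) (x : Icc (0 : ℝ) (N.len e)) :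
    IntervalIntegrable (g e) volume 0 x := by
  have h : Integrable (g e) (volume.restrict (Icc (0 : ℝ) (N.len e))) :=
    (Lp.memLp (g e)).integrable (by norm_num)
  rw [intervalIntegrable_iff_integrableOn_Icc_of_le x.2.1]
  exact IntegrableOn.mono_set h (Icc_subset_Icc le_rfl x.2.2)

theorem ae_restrict_uIoc {e : E} (x : Icc (0 : ℝ) (N.len e)) {P : ℝ → Prop}
    (h : ∀ᵐ y ∂(volume.restrict (Icc (0 : ℝ) (N.len e))), P y) :
    ∀ᵐ y ∂volume, y ∈ uIoc (0 : ℝ) x → P y := by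
  rw [ae_restrict_iff' measurableSet_Icc] at h
  filter_upwards [h] with y hy hm
  rw [uIoc_of_le x.2.1] at hm
  exact hy ⟨hm.1.le, hm.2.trans x.2.2⟩

/-- The broken Sobolev space `H¹(E)`: pairs `(q, g)` such that on every pipe `qᵉ` is the (continuous
representative of the) primitive of the square integrable function `gᵉ`, so that `g` is the broken
derivative of `q`.  On a bounded interval these are exactly the functions with a square integrable
weak derivative.  The norm is `max (‖q‖_∞) (‖g‖_{L²})`, which is equivalent to the usual one. -/
noncomputable def H1 : Submodule ℝ ((∀ e, C(Icc (0 : ℝ) (N.len e), ℝ)) × N.L2) where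
  carrier := {r | ∀ e x, r.1 e x = r.1 e (N.start e) + ∫ y in (0 : ℝ)..x, r.2 e y}
  zero_mem' := by
    intro e x
    have h : ∫ y in (0 : ℝ)..x, ((0 : N.L2) e : ℝ → ℝ) y = ∫ y in (0 : ℝ)..x, (0 : ℝ) := by
      refine intervalIntegral.integral_congr_ae (N.ae_restrict_uIoc x ?_)
      exact Lp.coeFn_zero ℝ 2 _
    simpa using h.symm
  add_mem' := by
    intro r s hr hs e x
    have h : ∫ y in (0 : ℝ)..x, ((r.2 + s.2) e : ℝ → ℝ) y
        = ∫ y in (0 : ℝ)..x, (r.2 e y + s.2 e y) := by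
      refine intervalIntegral.integral_congr_ae (N.ae_restrict_uIoc x ?_)
      exact Lp.coeFn_add _ _
    rw [intervalIntegral.integral_add (N.intervalIntegrable_L2 _ e x)
      (N.intervalIntegrable_L2 _ e x)] at h
    have h1 := hr e x
    have h2 := hs e x
    simp only [Prod.fst_add, Prod.snd_add, Pi.add_apply, ContinuousMap.add_apply]
    rw [h, h1, h2]
    ring
  smul_mem' := by
    intro c r hr e x
    have h : ∫ y in (0 : ℝ)..x, ((c • r.2) e : ℝ → ℝ) y
        = ∫ y in (0 : ℝ)..x, c • r.2 e y := by
      refine intervalIntegral.integral_congr_ae (N.ae_restrict_uIoc x ?_)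
      exact Lp.coeFn_smul _ _
    rw [intervalIntegral.integral_smul] at h
    have h1 := hr e x
    simp only [Prod.smul_fst, Prod.smul_snd, Pi.smul_apply, ContinuousMap.smul_apply]
    rw [h, h1, smul_add]

/-- The broken derivative `∂ₓ' : H¹(E) → L²(E)`. -/
noncomputable def dx : N.H1 →ₗ[ℝ] N.L2 :=
  (LinearMap.snd ℝ (∀ e, C(Icc (0 : ℝ) (N.len e), ℝ)) N.L2).comp N.H1.subtype

theorem memLp_extend (e : E) (f : C(Icc (0 : ℝ) (N.len e), ℝ)) :
    MemLp (IccExtend (N.len_pos e).le f) 2 (volume.restrict (Icc (0 : ℝ) (N.len e))) := by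
  refine MemLp.of_bound (C := ‖f‖) ?_ ?_
  · exact (f.continuous.Icc_extend' (h := (N.len_pos e).le)).aestronglyMeasurable
  · exact Eventually.of_forall fun x => f.norm_coe_le_norm _

/-- The embedding `H¹(E) → L²(E)`. -/
noncomputable def toL2 : N.H1 →ₗ[ℝ] N.L2 where
  toFun q := WithLp.toLp 2 fun e => (N.memLp_extend e (q.1.1 e)).toLp _
  map_add' q r := by
    ext1 e
    exact MemLp.toLp_add (N.memLp_extend e (q.1.1 e)) (N.memLp_extend e (r.1.1 e))
  map_smul' c q := by
    ext1 e
    exact MemLp.toLp_const_smul c (N.memLp_extend e (q.1.1 e))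

/-- The sum `∑_{e ∈ E(v)} nᵉ(v) qᵉ(v)` over the pipes incident to `v`, where `nᵉ(v) = -1` if `e`
starts at `v` and `nᵉ(v) = 1` if `e` ends at `v`.  At an inner vertex this is `[n q](v)`. -/
noncomputable def nsum (q : N.H1) (v : V) : ℝ :=
  ∑ e, ((if N.head e = v then q.1.1 e (N.finish e) else 0)
    - (if N.tail e = v then q.1.1 e (N.start e) else 0))

/-- The output `y_v = - nᵉ(v) qᵉ(v)` at a port. -/
noncomputable def output (q : N.H1) (v : N.Port) : ℝ := - N.nsum q v

/-! ### The continuous problem -/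

/-- Classical solutions on `[0, T]` of the network problem
`a ∂ₜp + ∂ₓq = 0`, `b ∂ₜq + ∂ₓp + d q = 0` on every pipe, with flux balance and continuity of the
pressure at inner vertices and with pressure `u_v` at the ports.  Regularity:
`p, q ∈ C¹([0,T]; L²) ∩ C([0,T]; H¹)`. -/
structure IsClassicalSolution (T : ℝ) (u : ℝ → N.Port → ℝ) (p q : ℝ → N.H1) : Prop where
  p_cont : ContinuousOn p (Icc 0 T)
  q_cont : ContinuousOn q (Icc 0 T)
  p_diff : ContDiffOn ℝ 1 (fun t => N.toL2 (p t)) (Icc 0 T)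
  q_diff : ContDiffOn ℝ 1 (fun t => N.toL2 (q t)) (Icc 0 T)
  mass_eq : ∀ t ∈ Icc 0 T, ∀ e,
    N.a e • derivWithin (fun s => N.toL2 (p s)) (Icc 0 T) t e + N.dx (q t) e = 0
  momentum_eq : ∀ t ∈ Icc 0 T, ∀ e,
    N.b e • derivWithin (fun s => N.toL2 (q s)) (Icc 0 T) t e + N.dx (p t) e
      + N.d e • N.toL2 (q t) e = 0
  flux_balance : ∀ t ∈ Icc 0 T, ∀ v : N.Inner, N.nsum (q t) v = 0
  -- the pressure has a well-defined value `π v` at every vertex, prescribed at the ports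
  pressure : ∀ t ∈ Icc 0 T, ∃ π : V → ℝ,
    (∀ e, (p t).1.1 e (N.start e) = π (N.tail e) ∧ (p t).1.1 e (N.finish e) = π (N.head e)) ∧
    ∀ v : N.Port, π v = u t v

/-! ### Galerkin approximations -/

/-- `w ∈ H¹(0, T; X)`: `w` is a primitive of a square integrable function. -/
def MemH1Time {X : Type*} [NormedAddCommGroup X] [NormedSpace ℝ X] (T : ℝ) (w : ℝ → X) : Prop :=
  ∃ w' : ℝ → X, MemLp w' 2 (volume.restrict (Icc 0 T)) ∧
    ∀ t ∈ Icc 0 T, w t = w 0 + ∫ s in (0 : ℝ)..t, w' s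

variable (P : Submodule ℝ N.L2) (Q : Submodule ℝ N.H1)

/-- Solutions on `[0, T]` of the Galerkin system with approximation spaces `P ⊆ L²(E)` and
`Q ⊆ H¹(E)`, initial data `p₀`, `q₀` and input `u`. -/
structure IsGalerkinSolution (T : ℝ) (p₀ q₀ : N.L2) (u : ℝ → N.Port → ℝ)
    (p : ℝ → P) (q : ℝ → Q) (lam : ℝ → N.Inner → ℝ) : Prop where
  p_mem : MemH1Time T p
  q_mem : MemH1Time T q
  lam_mem : MemLp lam 2 (volume.restrict (Icc 0 T))
  p_init : ∀ φ ∈ P, inner ℝ (p 0 : N.L2) φ = inner ℝ p₀ φ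
  q_init : ∀ ψ ∈ Q, inner ℝ (N.toL2 (q 0)) (N.toL2 ψ) = inner ℝ q₀ (N.toL2 ψ)
  mass_eq : ∀ᵐ t ∂(volume.restrict (Icc 0 T)), ∀ φ ∈ P,
    N.wip N.a (deriv p t : P) φ + inner ℝ (N.dx (q t)) φ = 0
  momentum_eq : ∀ᵐ t ∂(volume.restrict (Icc 0 T)), ∀ ψ ∈ Q,
    N.wip N.b (N.toL2 (deriv q t : Q)) (N.toL2 ψ) - inner ℝ (p t : N.L2) (N.dx ψ)
      + N.wip N.d (N.toL2 (q t)) (N.toL2 ψ) + ∑ v : N.Inner, lam t v * N.nsum ψ v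
      = - ∑ v : N.Port, u t v * N.nsum ψ v
  flux_balance : ∀ t ∈ Icc 0 T, ∀ μ : N.Inner → ℝ, ∑ v : N.Inner, N.nsum (q t) v * μ v = 0

/-- Solutions of the stationary Galerkin system with constant input `u`. -/
structure IsSteadyState (u : N.Port → ℝ) (p : P) (q : Q) (lam : N.Inner → ℝ) : Prop where
  mass_eq : ∀ φ ∈ P, inner ℝ (N.dx q) φ = 0
  momentum_eq : ∀ ψ ∈ Q,
    - inner ℝ (p : N.L2) (N.dx ψ) + N.wip N.d (N.toL2 q) (N.toL2 ψ) + ∑ v : N.Inner, lam v * N.nsum ψ v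
      = - ∑ v : N.Port, u v * N.nsum ψ v
  flux_balance : ∀ μ : N.Inner → ℝ, ∑ v : N.Inner, N.nsum q v * μ v = 0

/-- `1 ∈ P`. -/
def ContainsOne : Prop :=
  ∃ p ∈ P, ∀ e, ∀ᵐ x ∂(volume.restrict (Icc (0 : ℝ) (N.len e))), p e x = 1

/-- `∂ₓ' Q = P`. -/
def DerivSurj : Prop := Q.map N.dx = P

/-- `1ᵉ ∈ Q` for all pipes `e`. -/
def ContainsIndicators : Prop :=
  ∀ e, ∃ q ∈ Q, (∀ x, q.1.1 e x = 1) ∧ ∀ e', e' ≠ e → ∀ x, q.1.1 e' x = 0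

/-- Conservation of mass: `d/dt m(t) = ∑_v y_v(t)` for all solutions. -/
def MassConservation : Prop :=
  ∀ T > 0, ∀ (p₀ q₀ : N.L2) (u : ℝ → N.Port → ℝ) (p : ℝ → P) (q : ℝ → Q) (lam : ℝ → N.Inner → ℝ),
    N.IsGalerkinSolution P Q T p₀ q₀ u p q lam →
    ∀ t ∈ Icc 0 T, HasDerivWithinAt (fun s => N.mass (p s)) (∑ v : N.Port, N.output (q t) v) (Icc 0 T) t

/-- Energy balance `d/dt E(t) = - ∑ₑ ∫ₑ dᵉ |qᵉ(t)|² dx + ∑_v y_v(t) u_v(t)` for all solutions.  The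
energy is absolutely continuous and the identity holds for almost all times, and for all times if
the input is continuous. -/
def EnergyBalance : Prop :=
  ∀ T > 0, ∀ (p₀ q₀ : N.L2) (u : ℝ → N.Port → ℝ) (p : ℝ → P) (q : ℝ → Q) (lam : ℝ → N.Inner → ℝ),
    N.IsGalerkinSolution P Q T p₀ q₀ u p q lam →
    AbsolutelyContinuousOnInterval (fun s => N.energy (p s) (N.toL2 (q s))) 0 T ∧
    (∀ᵐ t ∂(volume.restrict (Icc 0 T)), HasDerivAt (fun s => N.energy (p s) (N.toL2 (q s)))
      (- N.wip N.d (N.toL2 (q t)) (N.toL2 (q t)) + ∑ v : N.Port, N.output (q t) v * u t v) t) ∧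
    (ContinuousOn u (Icc 0 T) → ∀ t ∈ Icc 0 T,
      HasDerivWithinAt (fun s => N.energy (p s) (N.toL2 (q s)))
        (- N.wip N.d (N.toL2 (q t)) (N.toL2 (q t)) + ∑ v : N.Port, N.output (q t) v * u t v) (Icc 0 T) t)

/-- Exponential stability of the Galerkin system with constants `C`, `γ`: the energy of every
solution decays on every time interval on which the input vanishes. -/
def ExpStable (C γ : ℝ) : Prop :=
  ∀ T > 0, ∀ (p₀ q₀ : N.L2) (u : ℝ → N.Port → ℝ) (p : ℝ → P) (q : ℝ → Q) (lam : ℝ → N.Inner → ℝ),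
    N.IsGalerkinSolution P Q T p₀ q₀ u p q lam →
    ∀ t₁ t₂, 0 ≤ t₁ → t₂ ≤ T → (∀ t ∈ Icc t₁ t₂, u t = 0) →
    ∀ s t, t₁ ≤ s → s ≤ t → t ≤ t₂ →
      N.energy (p t) (N.toL2 (q t))
        ≤ C * Real.exp (-γ * (t - s)) * N.energy (p s) (N.toL2 (q s))

/-- Exponential stability of the continuous network problem with constants `C`, `γ`. -/
def ContinuousExpStable (C γ : ℝ) : Prop :=
  ∀ T > 0, ∀ (u : ℝ → N.Port → ℝ) (p q : ℝ → N.H1), N.IsClassicalSolution T u p q →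
    ∀ t₁ t₂, 0 ≤ t₁ → t₂ ≤ T → (∀ t ∈ Icc t₁ t₂, u t = 0) →
    ∀ s t, t₁ ≤ s → s ≤ t → t ≤ t₂ →
      N.energy (N.toL2 (p t)) (N.toL2 (q t))
        ≤ C * Real.exp (-γ * (t - s)) * N.energy (N.toL2 (p s)) (N.toL2 (q s))

/-- Unique steady states: for every constant input the stationary system has exactly one solution,
and every solution of the evolution problem whose input has this constant value after some time
`t₀` converges to it, exponentially with the constants `C`, `γ`. -/
def UniqueStableSteadyStates (C γ : ℝ) : Prop :=
  ∀ ubar : N.Port → ℝ, ∃ (pbar : P) (qbar : Q) (lbar : N.Inner → ℝ),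
    N.IsSteadyState P Q ubar pbar qbar lbar ∧
    (∀ p q lam, N.IsSteadyState P Q ubar p q lam → p = pbar ∧ q = qbar ∧ lam = lbar) ∧
    ∀ (p₀ q₀ : N.L2) (u : ℝ → N.Port → ℝ) (p : ℝ → P) (q : ℝ → Q) (lam : ℝ → N.Inner → ℝ) (t₀ : ℝ),
      0 ≤ t₀ → (∀ t, t₀ ≤ t → u t = ubar) →
      (∀ T > 0, N.IsGalerkinSolution P Q T p₀ q₀ u p q lam) →
      (∀ s t, t₀ ≤ s → s ≤ t →
        N.energy (p t - pbar : P) (N.toL2 (q t - qbar : Q))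
          ≤ C * Real.exp (-γ * (t - s)) * N.energy (p s - pbar : P) (N.toL2 (q s - qbar : Q))) ∧
      Tendsto p atTop (𝓝 pbar) ∧ Tendsto q atTop (𝓝 qbar)

end Network

/-! With zero input the energy is damped only through `q`: its rate is `-(d q, q)`. Damping of `p`
is recovered by subtracting a small multiple of the mixed term `(b q, F G p)`. Here `G` is
multiplication by `a` followed by the orthogonal projection onto `P`, and `F` sends `g` to a
flux-balanced potential of `g`, regarded as an element of `L²`. The potential of `G p` is an
admissible test function in the momentum equation. It produces `(p, G p) = (a p, p)`, and the
multipliers drop out. The mass equation says `G p' = -∂ₓ' q`, so the remaining part of the rate is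
harmless as soon as `F ∂ₓ'` is bounded in `L²` on balanced fluxes.

Such an `F` comes from `exists_potential`: a primitive is corrected by edgewise constants to balance
the fluxes, and then made orthogonal to the balanced edgewise constants. The correction exists
because edgewise constants attain all inner flux values (`flux_const_surjective`), which rests on
connectedness and the presence of a port. `F` is fixed before `P` and `Q`. The compatibility
conditions `∂ₓ' Q = P` and `1ᵉ ∈ Q` only guarantee that its potentials lie in `Q`, so the constants
in `exists_lyapunov` and `exists_decay` depend on the network alone. The continuous problem is the
case `P = ⊤`, `Q = ⊤`, hence shares these constants.

The balance laws follow by testing with `1` and with the solution itself. The stationary system is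
square with trivial kernel, and the decay estimate applies to the difference between a solution and
the steady state. -/

namespace AbsolutelyContinuousOnInterval

/-! ### Absolutely continuous functions of one variable -/

theorem lipschitzWith_comp {X Y : Type*} [PseudoMetricSpace X] [PseudoMetricSpace Y] {φ : X → Y}
    {K : NNReal} (hφ : LipschitzWith K φ) {f : ℝ → X} {a b : ℝ}
    (hf : AbsolutelyContinuousOnInterval f a b) :
    AbsolutelyContinuousOnInterval (fun t => φ (f t)) a b := by
  refine squeeze_zero (fun t => Finset.sum_nonneg fun i _ => dist_nonneg) (fun t => ?_)
    (by simpa using Tendsto.const_mul (K : ℝ) hf)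
  rw [Finset.mul_sum]
  exact Finset.sum_le_sum fun i _ => hφ.dist_le_mul _ _

theorem clm_comp {X Y : Type*} [NormedAddCommGroup X] [NormedSpace ℝ X] [NormedAddCommGroup Y]
    [NormedSpace ℝ Y] (L : X →L[ℝ] Y) {f : ℝ → X} {a b : ℝ}
    (hf : AbsolutelyContinuousOnInterval f a b) :
    AbsolutelyContinuousOnInterval (fun t => L (f t)) a b :=
  hf.lipschitzWith_comp L.lipschitz

/-- Polarization reduces the claim to products of the scalar functions `‖f + g‖` and `‖f - g‖`. -/
theorem inner {X : Type*} [NormedAddCommGroup X] [InnerProductSpace ℝ X] {f g : ℝ → X} {a b : ℝ}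
    (hf : AbsolutelyContinuousOnInterval f a b) (hg : AbsolutelyContinuousOnInterval g a b) :
    AbsolutelyContinuousOnInterval (fun t => inner ℝ (f t) (g t)) a b := by
  have h1 := (hf.add hg).lipschitzWith_comp lipschitzWith_one_norm
  have h2 := (hf.sub hg).lipschitzWith_comp lipschitzWith_one_norm
  have h := ((h1.mul h1).sub (h2.mul h2)).const_mul (1 / 4)
  convert h using 2 with t
  simp [real_inner_eq_norm_mul_self_add_norm_mul_self_sub_norm_sub_mul_self_div_two,
    Pi.add_apply, Pi.sub_apply]
  have := parallelogram_law_with_norm ℝ (f t) (g t)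
  linarith

/-- The primitive of an integrable function is absolutely continuous. -/
theorem of_eq_add_integral {X : Type*} [NormedAddCommGroup X] [NormedSpace ℝ X]
    {f f' : ℝ → X} {T : ℝ} (hT : 0 ≤ T) (hf' : IntervalIntegrable f' volume 0 T)
    (h : ∀ t ∈ Icc 0 T, f t = f 0 + ∫ s in (0 : ℝ)..t, f' s) :
    AbsolutelyContinuousOnInterval f 0 T := by
  -- Increments of `f` are dominated by those of the primitive of `‖f'‖`, so the scalar case
  -- suffices.
  have hn := hf'.norm.absolutelyContinuousOnInterval_intervalIntegral (c := 0) (by simp)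
  refine squeeze_zero' (Eventually.of_forall fun t => Finset.sum_nonneg fun i _ => dist_nonneg)
    ?_ hn
  rw [eventually_inf_principal]
  filter_upwards with ⟨n, I⟩ hI
  refine Finset.sum_le_sum fun i hi => ?_
  obtain ⟨h1, h2⟩ := hI.1 i hi
  have hint : ∀ r ∈ uIcc 0 T, IntervalIntegrable f' volume 0 r := fun r hr =>
    hf'.mono_set (uIcc_subset_uIcc left_mem_uIcc hr)
  have h3 := hint _ h1
  have h4 := hint _ h2
  rw [uIcc_of_le hT] at h1 h2
  rw [h _ h1, h _ h2, dist_add_left, dist_eq_norm, Real.dist_eq,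
    intervalIntegral.integral_interval_sub_left h3 h4,
    intervalIntegral.integral_interval_sub_left h3.norm h4.norm]
  exact intervalIntegral.norm_integral_le_abs_integral_norm

/-- A function with almost everywhere nonpositive derivative does not increase. -/
theorem le_of_ae_deriv_nonpos {f : ℝ → ℝ} {a b : ℝ} (hab : a ≤ b)
    (hf : AbsolutelyContinuousOnInterval f a b)
    (h : ∀ᵐ t, t ∈ Icc a b → ∃ f', HasDerivAt f f' t ∧ f' ≤ 0) : f b ≤ f a := by
  have h0 : 0 ≤ ∫ t in a..b, - deriv f t := by
    refine intervalIntegral.integral_nonneg_of_ae_restrict hab ?_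
    rw [EventuallyLE, ae_restrict_iff' measurableSet_Icc]
    filter_upwards [h] with t ht hm
    obtain ⟨f', h1, h2⟩ := ht hm
    rw [h1.deriv]
    simpa using h2
  rw [intervalIntegral.integral_neg, hf.integral_deriv_eq_sub] at h0
  linarith

/-- Gronwall's lemma for absolutely continuous functions. -/
theorem le_exp_mul_of_ae_deriv_le {f : ℝ → ℝ} {a b γ : ℝ} (hab : a ≤ b)
    (hf : AbsolutelyContinuousOnInterval f a b)
    (h : ∀ᵐ t, t ∈ Icc a b → ∃ f', HasDerivAt f f' t ∧ f' ≤ -γ * f t) :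
    f b ≤ Real.exp (-γ * (b - a)) * f a := by
  have he : AbsolutelyContinuousOnInterval (fun t => Real.exp (γ * t)) a b :=
    ContDiffOn.absolutelyContinuousOnInterval (by fun_prop)
  -- The integrating factor `exp (γ t)` makes the product nonincreasing.
  have hm := le_of_ae_deriv_nonpos hab (he.fun_mul hf) (by
    filter_upwards [h] with t ht hm
    obtain ⟨f', h1, h2⟩ := ht hm
    have h3 : HasDerivAt (fun t => Real.exp (γ * t)) (Real.exp (γ * t) * (γ * 1)) t :=
      ((hasDerivAt_id t).const_mul γ).exp
    refine ⟨_, h3.fun_mul h1, ?_⟩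
    have := mul_le_mul_of_nonneg_left h2 (Real.exp_pos (γ * t)).le
    linarith)
  have h4 : f b = Real.exp (-γ * b) * (Real.exp (γ * b) * f b) := by
    rw [← mul_assoc, ← Real.exp_add]; simp
  rw [h4, show -γ * (b - a) = -γ * b + γ * a by ring, Real.exp_add, mul_assoc]
  exact mul_le_mul_of_nonneg_left hm (Real.exp_pos _).le

/-- An absolutely continuous function whose derivative agrees almost everywhere with a continuous
function is continuously differentiable. -/
theorem hasDerivWithinAt_of_ae {f g : ℝ → ℝ} {a b : ℝ}
    (hf : AbsolutelyContinuousOnInterval f a b) (hg : ContinuousOn g (Icc a b))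
    (h : ∀ᵐ t, t ∈ Icc a b → HasDerivAt f (g t) t) {t : ℝ} (ht : t ∈ Icc a b) :
    HasDerivWithinAt f (g t) (Icc a b) t := by
  have hab : a ≤ b := ht.1.trans ht.2
  have hi : IntervalIntegrable g volume a b := hg.intervalIntegrable_of_Icc hab
  have hft : ∀ s ∈ Icc a b, f s = f a + ∫ r in a..s, g r := by
    intro s hs
    have h1 := (hf.mono (c := a) (d := s) (by
      rw [uIcc_of_le hs.1, uIcc_of_le hab]; exact Icc_subset_Icc le_rfl hs.2)).integral_deriv_eq_sub
    have h2 : ∫ r in a..s, deriv f r = ∫ r in a..s, g r := by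
      refine intervalIntegral.integral_congr_ae ?_
      filter_upwards [h] with r hr hm
      rw [uIoc_of_le hs.1] at hm
      exact (hr ⟨hm.1.le, hm.2.trans hs.2⟩).deriv
    linarith
  have : Fact (t ∈ Icc a b) := ⟨ht⟩
  have hd : HasDerivWithinAt (fun s => ∫ r in a..s, g r) (g t) (Icc a b) t := by
    refine intervalIntegral.integral_hasDerivWithinAt_right (hi.mono_set ?_) ?_ (hg t ht)
    · rw [uIcc_of_le ht.1, uIcc_of_le hab]; exact Icc_subset_Icc le_rfl ht.2
    · exact hg.stronglyMeasurableAtFilter_nhdsWithin measurableSet_Icc t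
  exact (hd.const_add (f a)).congr hft (hft t ht)

end AbsolutelyContinuousOnInterval

/-! ### Weighted inner products and coefficient bounds -/

namespace Network

variable {V E : Type*} [Fintype V] [DecidableEq V] [Fintype E] (N : Network V E)

/-- Multiplication by an edgewise constant weight. -/
noncomputable def wmul (w : E → ℝ) : N.L2 →L[ℝ] N.L2 where
  toFun f := WithLp.toLp 2 fun e => w e • f e
  map_add' f g := by ext1 e; simp
  map_smul' c f := by ext1 e; exact smul_comm (w e) c (f e)
  cont := by fun_prop

theorem wmul_apply (w : E → ℝ) (f : N.L2) (e : E) : N.wmul w f e = w e • f e := rfl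

theorem wip_eq_inner (w : E → ℝ) (f g : N.L2) : N.wip w f g = inner ℝ (N.wmul w f) g := by
  simp [wip, PiLp.inner_apply, wmul_apply, inner_smul_left]

theorem wip_comm (w : E → ℝ) (f g : N.L2) : N.wip w f g = N.wip w g f := by
  simp [wip, real_inner_comm]

theorem wip_sub_left (w : E → ℝ) (f g h : N.L2) :
    N.wip w (f - g) h = N.wip w f h - N.wip w g h := by
  simp [wip_eq_inner, inner_sub_left]

theorem norm_wmul_le {w : E → ℝ} {c : ℝ} (hc : 0 ≤ c) (h : ∀ e, |w e| ≤ c) (f : N.L2) :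
    ‖N.wmul w f‖ ≤ c * ‖f‖ := by
  refine le_of_sq_le_sq ?_ (by positivity)
  rw [mul_pow, PiLp.norm_sq_eq_of_L2, PiLp.norm_sq_eq_of_L2, Finset.mul_sum]
  refine Finset.sum_le_sum fun e _ => ?_
  rw [wmul_apply, norm_smul, mul_pow]
  gcongr
  exact h e

theorem abs_wip_le {w : E → ℝ} {c : ℝ} (hc : 0 ≤ c) (h : ∀ e, |w e| ≤ c) (f g : N.L2) :
    |N.wip w f g| ≤ c * ‖f‖ * ‖g‖ := by
  rw [wip_eq_inner]
  exact (abs_real_inner_le_norm _ _).trans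
    (mul_le_mul_of_nonneg_right (N.norm_wmul_le hc h f) (norm_nonneg _))

theorem mul_norm_sq_le_wip {w : E → ℝ} {c : ℝ} (h : ∀ e, c ≤ w e) (f : N.L2) :
    c * ‖f‖ ^ 2 ≤ N.wip w f f := by
  rw [PiLp.norm_sq_eq_of_L2, Finset.mul_sum]
  refine Finset.sum_le_sum fun e _ => ?_
  rw [real_inner_self_eq_norm_sq]
  gcongr
  exact h e

/-- The coefficients are bounded above and bounded away from zero. -/
theorem exists_coeff_bounds : ∃ c₀ c₁ : ℝ, 0 < c₀ ∧ c₀ ≤ c₁ ∧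
    ∀ e, (c₀ ≤ N.a e ∧ |N.a e| ≤ c₁) ∧ (c₀ ≤ N.b e ∧ |N.b e| ≤ c₁) ∧
      (c₀ ≤ N.d e ∧ |N.d e| ≤ c₁) := by
  have key : ∀ w : E → ℝ, (∀ e, 0 < w e) → ∃ c₀ c₁ : ℝ, 0 < c₀ ∧ ∀ e, c₀ ≤ w e ∧ |w e| ≤ c₁ := by
    intro w hw
    obtain ⟨C, hC⟩ := Finite.exists_le (fun e => |w e|)
    obtain ⟨D, hD⟩ := Finite.exists_le (fun e => (w e)⁻¹)
    refine ⟨(max D 1)⁻¹, C, by positivity, fun e => ⟨?_, hC e⟩⟩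
    exact inv_le_of_inv_le₀ (hw e) ((hD e).trans (le_max_left _ _))
  obtain ⟨a₀, a₁, ha, ha'⟩ := key N.a N.a_pos
  obtain ⟨b₀, b₁, hb, hb'⟩ := key N.b N.b_pos
  obtain ⟨d₀, d₁, hd, hd'⟩ := key N.d N.d_pos
  refine ⟨min a₀ (min b₀ d₀), max (max a₁ (max b₁ d₁)) (min a₀ (min b₀ d₀)),
    lt_min ha (lt_min hb hd), le_max_right _ _, fun e => ?_⟩
  obtain ⟨h1, h2⟩ := ha' e
  obtain ⟨h3, h4⟩ := hb' e
  obtain ⟨h5, h6⟩ := hd' e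
  refine ⟨⟨?_, ?_⟩, ⟨?_, ?_⟩, ⟨?_, ?_⟩⟩ <;> simp [*]

/-! ### The broken Sobolev space -/

theorem coeFn_toL2 (q : N.H1) (e : E) :
    N.toL2 q e =ᵐ[volume.restrict (Icc (0 : ℝ) (N.len e))] IccExtend (N.len_pos e).le (q.1.1 e) :=
  MemLp.coeFn_toLp (N.memLp_extend e (q.1.1 e))

theorem intervalIntegrable_coeFn (g : N.L2) (e : E) :
    IntervalIntegrable (g e) volume 0 (N.len e) :=
  N.intervalIntegrable_L2 g e (N.finish e)

/-- A square integrable function whose primitive vanishes is zero. -/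
theorem eq_zero_of_primitive_eq_zero {g : N.L2}
    (h : ∀ e, ∀ x ∈ Icc 0 (N.len e), ∫ y in (0 : ℝ)..x, g e y = 0) : g = 0 := by
  ext1 e
  refine Lp.ext (EventuallyEq.trans ?_ (Lp.coeFn_zero ℝ 2 _).symm)
  have key : ∀ᵐ x ∂(volume.restrict (Ioo (0 : ℝ) (N.len e))), g e x = 0 := ?_
  · rwa [restrict_Ioo_eq_restrict_Icc] at key
  rw [ae_restrict_iff' measurableSet_Ioo]
  -- By Lebesgue differentiation the integrand is almost everywhere the derivative of its primitive,
  -- which vanishes near every interior point.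
  filter_upwards [(N.intervalIntegrable_coeFn g e).ae_hasDerivAt_integral] with x hx hm
  have hm' : x ∈ uIcc 0 (N.len e) := by
    rw [uIcc_of_le (N.len_pos e).le]; exact Ioo_subset_Icc_self hm
  have h1 := hx hm' 0 left_mem_uIcc
  have h2 : HasDerivAt (fun x => ∫ y in (0 : ℝ)..x, g e y) 0 x := by
    refine (hasDerivAt_const x (0 : ℝ)).congr_of_eventuallyEq ?_
    filter_upwards [Icc_mem_nhds hm.1 hm.2] with y hy using h e y hy
  exact h1.unique h2

/-- A function in `H¹` is zero if it vanishes at the starting points and has derivative zero. -/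
theorem H1_ext {q r : N.H1} (h : ∀ e, q.1.1 e (N.start e) = r.1.1 e (N.start e))
    (h' : N.dx q = N.dx r) : q = r := by
  have h'' : q.1.2 = r.1.2 := h'
  refine Subtype.ext (Prod.ext ?_ h'')
  funext e
  ext x
  rw [q.2 e x, r.2 e x, h e, h'']

/-- The derivative component carries no extra information: a square integrable function is
determined by its primitive. -/
theorem H1_ext_fst {q r : N.H1} (h : q.1.1 = r.1.1) : q = r := by
  refine N.H1_ext (fun e => by rw [h]) ?_
  rw [← sub_eq_zero, ← map_sub]
  refine N.eq_zero_of_primitive_eq_zero fun e x hx => ?_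
  have h1 := (q - r).2 e ⟨x, hx⟩
  have h2 : (q - r).1.1 = 0 := by
    have : (q - r).1.1 = q.1.1 - r.1.1 := rfl
    rw [this, h, sub_self]
  rw [h2] at h1
  simp only [Pi.zero_apply, ContinuousMap.zero_apply, zero_add] at h1
  exact h1.symm

/-- Continuous functions that agree almost everywhere on a nondegenerate interval agree everywhere,
so passing to classes loses nothing. -/
theorem toL2_injective : Function.Injective N.toL2 := by
  intro q r h
  refine N.H1_ext_fst ?_
  funext e
  have h1 : IccExtend (N.len_pos e).le (q.1.1 e) =ᵐ[volume.restrict (Icc (0 : ℝ) (N.len e))]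
      IccExtend (N.len_pos e).le (r.1.1 e) :=
    (N.coeFn_toL2 q e).symm.trans ((by rw [h] : N.toL2 q e =ᵐ[_] N.toL2 r e).trans
      (N.coeFn_toL2 r e))
  have h2 := Measure.eqOn_Icc_of_ae_eq volume (N.len_pos e).ne h1
    ((q.1.1 e).continuous.Icc_extend').continuousOn ((r.1.1 e).continuous.Icc_extend').continuousOn
  ext x
  have h3 := h2 x.2
  simpa [IccExtend_of_mem] using h3

theorem exists_primitive (g : N.L2) :
    ∃ q : N.H1, (∀ e, q.1.1 e (N.start e) = 0) ∧ N.dx q = g := by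
  have hc (e : E) : Continuous fun x : Icc (0 : ℝ) (N.len e) => ∫ y in (0 : ℝ)..x, g e y := by
    have h := intervalIntegral.continuousOn_primitive_interval (a := 0) (b := N.len e)
      (f := g e) (μ := volume) (by
        rw [uIcc_of_le (N.len_pos e).le]
        exact (Lp.memLp (g e)).integrable (by norm_num))
    rw [uIcc_of_le (N.len_pos e).le] at h
    exact continuousOn_iff_continuous_domRestrict.1 h
  have h0 (e : E) : (⟨_, hc e⟩ : C(Icc (0 : ℝ) (N.len e), ℝ)) (N.start e) = 0 :=
    intervalIntegral.integral_same
  refine ⟨⟨(fun e => ⟨_, hc e⟩, g), fun e x => ?_⟩, h0, rfl⟩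
  change _ = (⟨_, hc e⟩ : C(Icc (0 : ℝ) (N.len e), ℝ)) (N.start e) + _
  rw [h0, zero_add]
  rfl

/-- The primitive of a square integrable function that vanishes at all starting points. -/
noncomputable def primitive : N.L2 →ₗ[ℝ] N.H1 where
  toFun g := (N.exists_primitive g).choose
  map_add' f g := by
    have h := fun g => (N.exists_primitive g).choose_spec
    refine N.H1_ext (fun e => ?_) ?_
    · change _ = (N.exists_primitive f).choose.1.1 e (N.start e)
        + (N.exists_primitive g).choose.1.1 e (N.start e)
      rw [(h _).1, (h _).1, (h _).1, add_zero]
    · rw [map_add, (h _).2, (h _).2, (h _).2]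
  map_smul' c g := by
    have h := fun g => (N.exists_primitive g).choose_spec
    refine N.H1_ext (fun e => ?_) ?_
    · change _ = c * (N.exists_primitive g).choose.1.1 e (N.start e)
      rw [(h _).1, (h _).1, mul_zero]
    · rw [RingHom.id_apply, map_smul, (h _).2, (h _).2]

theorem primitive_start (g : N.L2) (e : E) : (N.primitive g).1.1 e (N.start e) = 0 :=
  (N.exists_primitive g).choose_spec.1 e

theorem dx_primitive (g : N.L2) : N.dx (N.primitive g) = g :=
  (N.exists_primitive g).choose_spec.2

/-- Edgewise constant functions. -/
noncomputable def const : (E → ℝ) →ₗ[ℝ] N.H1 where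
  toFun c := ⟨(fun e => ContinuousMap.const _ (c e), 0), fun e x => by
    have h : ∫ y in (0 : ℝ)..x, ((0 : N.L2) e : ℝ → ℝ) y = ∫ y in (0 : ℝ)..x, (0 : ℝ) := by
      refine intervalIntegral.integral_congr_ae (N.ae_restrict_uIoc x ?_)
      exact Lp.coeFn_zero ℝ 2 _
    rw [h]
    simp⟩
  map_add' c c' := by ext <;> simp
  map_smul' r c := by ext <;> simp

theorem const_apply (c : E → ℝ) (e : E) (x : Icc (0 : ℝ) (N.len e)) :
    (N.const c).1.1 e x = c e := rfl

theorem dx_const (c : E → ℝ) : N.dx (N.const c) = 0 := rfl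

theorem eq_const_of_dx_eq_zero {q : N.H1} (h : N.dx q = 0) :
    q = N.const fun e => q.1.1 e (N.start e) :=
  N.H1_ext (fun _ => rfl) (by rw [h, dx_const])

/-! ### Integration by parts -/

/-- On every pipe, a function in `H¹` is the restriction of an absolutely continuous function. -/
theorem exists_absolutelyContinuous (q : N.H1) (e : E) : ∃ f : ℝ → ℝ,
    AbsolutelyContinuousOnInterval f 0 (N.len e) ∧
    f 0 = q.1.1 e (N.start e) ∧ f (N.len e) = q.1.1 e (N.finish e) ∧
    f =ᵐ[volume.restrict (Icc 0 (N.len e))] N.toL2 q e ∧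
    deriv f =ᵐ[volume.restrict (Icc 0 (N.len e))] N.dx q e := by
  have hi := N.intervalIntegrable_coeFn (N.dx q) e
  have hq : ∀ x : Icc 0 (N.len e), q.1.1 e x = q.1.1 e (N.start e) + ∫ y in (0 : ℝ)..x, N.dx q e y :=
    q.2 e
  refine ⟨fun x => q.1.1 e (N.start e) + ∫ y in (0 : ℝ)..x, N.dx q e y, ?_, by simp,
    (hq (N.finish e)).symm, ?_, ?_⟩
  · refine AbsolutelyContinuousOnInterval.of_eq_add_integral (N.len_pos e).le hi fun t _ => ?_
    simp
  · refine EventuallyEq.trans ?_ (N.coeFn_toL2 q e).symm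
    refine (ae_restrict_iff' measurableSet_Icc).2 (Eventually.of_forall fun x hx => ?_)
    rw [IccExtend_of_mem _ _ hx]
    exact (hq ⟨x, hx⟩).symm
  · refine (ae_restrict_iff' measurableSet_Icc).2 ?_
    filter_upwards [hi.ae_hasDerivAt_integral] with x hx hm
    rw [← uIcc_of_le (N.len_pos e).le] at hm
    exact ((hx hm 0 left_mem_uIcc).const_add _).deriv

/-- On each pipe this is the product rule for the absolutely continuous representatives. -/
theorem inner_dx_add_inner_dx (p q : N.H1) :
    inner ℝ (N.dx p) (N.toL2 q) + inner ℝ (N.toL2 p) (N.dx q)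
      = ∑ e, (p.1.1 e (N.finish e) * q.1.1 e (N.finish e)
        - p.1.1 e (N.start e) * q.1.1 e (N.start e)) := by
  rw [PiLp.inner_apply, PiLp.inner_apply, ← Finset.sum_add_distrib]
  refine Finset.sum_congr rfl fun e _ => ?_
  obtain ⟨f, hf, hf0, hf1, hfp, hfd⟩ := N.exists_absolutelyContinuous p e
  obtain ⟨g, hg, hg0, hg1, hgq, hgd⟩ := N.exists_absolutelyContinuous q e
  rw [← hf0, ← hf1, ← hg0, ← hg1, ← hf.integral_deriv_mul_eq_sub hg, L2.inner_def, L2.inner_def,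
    ← integral_add (L2.integrable_inner _ _) (L2.integrable_inner _ _),
    intervalIntegral.integral_of_le (N.len_pos e).le, ← integral_Icc_eq_integral_Ioc]
  refine integral_congr_ae ?_
  filter_upwards [hfp, hfd, hgq, hgd] with x h1 h2 h3 h4
  simp only [h1, h2, h3, h4, RCLike.inner_apply, conj_trivial]
  ring

/-- The fluxes at the vertices add up to the jumps along the pipes, weighted with a potential. -/
theorem sum_mul_nsum (π : V → ℝ) (q : N.H1) :
    ∑ v, π v * N.nsum q v = ∑ e, (π (N.head e) * q.1.1 e (N.finish e)
      - π (N.tail e) * q.1.1 e (N.start e)) := by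
  simp only [nsum, Finset.mul_sum]
  rw [Finset.sum_comm]
  refine Finset.sum_congr rfl fun e _ => ?_
  simp [mul_sub, Finset.sum_sub_distrib]

theorem sum_eq_sum_inner_add_sum_port (f : V → ℝ) :
    ∑ v, f v = ∑ v : N.Inner, f v + ∑ v : N.Port, f v := by
  rw [add_comm]
  convert (Fintype.sum_subtype_add_sum_subtype (fun v => v ∈ N.ports) f).symm

theorem inner_dx_const (q : N.H1) (c : E → ℝ) :
    inner ℝ (N.dx q) (N.toL2 (N.const c))
      = ∑ e, c e * (q.1.1 e (N.finish e) - q.1.1 e (N.start e)) := by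
  have h := N.inner_dx_add_inner_dx q (N.const c)
  rw [dx_const, inner_zero_right, add_zero] at h
  rw [h]
  simp only [const_apply]
  exact Finset.sum_congr rfl fun e _ => by ring

theorem coeFn_toL2_const (c : E → ℝ) (e : E) :
    ∀ᵐ x ∂(volume.restrict (Icc (0 : ℝ) (N.len e))), N.toL2 (N.const c) e x = c e := by
  filter_upwards [N.coeFn_toL2 (N.const c) e] with x hx
  rw [hx]
  rfl

/-- In this form the mass is the quantity obtained by testing with the constant function `1`. -/
theorem mass_eq_wip (p : N.L2) : N.mass p = N.wip N.a p (N.toL2 (N.const 1)) := by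
  refine Finset.sum_congr rfl fun e _ => ?_
  rw [intervalIntegral.integral_const_mul, L2.inner_def,
    intervalIntegral.integral_of_le (N.len_pos e).le, ← integral_Icc_eq_integral_Ioc]
  congr 1
  refine integral_congr_ae ?_
  filter_upwards [N.coeFn_toL2_const 1 e] with x hx
  simp [hx]

end Network

namespace Network

variable {V E : Type*} [Fintype V] [DecidableEq V] [Fintype E] (N : Network V E)

/-! ### Potentials of square integrable functions -/

theorem nsum_add (q r : N.H1) (v : V) : N.nsum (q + r) v = N.nsum q v + N.nsum r v := by
  simp only [nsum, ← Finset.sum_add_distrib]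
  refine Finset.sum_congr rfl fun e _ => ?_
  have h : ∀ x, (q + r).1.1 e x = q.1.1 e x + r.1.1 e x := fun _ => rfl
  rw [h, h]
  split_ifs <;> ring

theorem nsum_smul (c : ℝ) (q : N.H1) (v : V) : N.nsum (c • q) v = c * N.nsum q v := by
  simp only [nsum, Finset.mul_sum]
  refine Finset.sum_congr rfl fun e _ => ?_
  have h : ∀ x, (c • q).1.1 e x = c * q.1.1 e x := fun _ => rfl
  rw [h, h]
  split_ifs <;> ring

/-- The flux balances at the inner vertices. -/
noncomputable def flux : N.H1 →ₗ[ℝ] (N.Inner → ℝ) where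
  toFun q v := N.nsum q v
  map_add' q r := funext fun v => N.nsum_add q r v
  map_smul' c q := funext fun v => N.nsum_smul c q v

theorem flux_apply (q : N.H1) (v : N.Inner) : N.flux q v = N.nsum q v := rfl

/-- A potential that does not change along the pipes is constant on the network. -/
theorem eq_of_head_eq_tail {π : V → ℝ} (h : ∀ e, π (N.head e) = π (N.tail e)) (v w : V) :
    π v = π w := by
  obtain ⟨p⟩ := N.connected.preconnected v w
  induction p with
  | nil => rfl
  | cons hadj _ ih =>
    rw [← ih]
    rw [SimpleGraph.fromRel_adj] at hadj
    obtain ⟨_, ⟨e, rfl, rfl⟩ | ⟨e, rfl, rfl⟩⟩ := hadj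
    · exact (h e).symm
    · exact h e

/-- Only the zero multiplier is orthogonal to the fluxes of all edgewise constant functions. -/
theorem multiplier_eq_zero {lam : N.Inner → ℝ}
    (h : ∀ c : E → ℝ, ∑ v, lam v * N.nsum (N.const c) v = 0) : lam = 0 := by
  classical
  -- Extended by zero at the ports, `lam` becomes a potential. Orthogonality to indicators of single
  -- pipes makes it constant along each pipe, and a port pins the constant to zero.
  let π : V → ℝ := fun v => if hv : v ∈ N.ports then 0 else lam ⟨v, hv⟩
  have hπ : ∀ v : N.Inner, π v = lam v := fun v => dif_neg v.2
  have hπ' : ∀ v : N.Port, π v = 0 := fun v => dif_pos v.2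
  have hsum : ∀ c : E → ℝ, ∑ e, c e * (π (N.head e) - π (N.tail e)) = 0 := by
    intro c
    have h1 := N.sum_mul_nsum π (N.const c)
    rw [N.sum_eq_sum_inner_add_sum_port] at h1
    simp only [hπ, hπ', h c, zero_mul, Finset.sum_const_zero, add_zero, const_apply] at h1
    rw [h1]
    exact Finset.sum_congr rfl fun e _ => by ring
  have hedge : ∀ e, π (N.head e) = π (N.tail e) := by
    intro e
    have h1 := hsum (Pi.single e 1)
    rw [Finset.sum_eq_single e (fun e' _ he => by simp [he]) (by simp)] at h1
    simpa [sub_eq_zero] using h1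
  obtain ⟨w, hw⟩ := N.ports_nonempty
  funext v
  rw [← hπ v, N.eq_of_head_eq_tail hedge v w]
  exact hπ' ⟨w, hw⟩

/-- By duality it is enough that the transpose is injective, which is `multiplier_eq_zero`. -/
theorem flux_const_surjective : Function.Surjective (N.flux ∘ₗ N.const) := by
  classical
  rw [← LinearMap.dualMap_injective_iff, injective_iff_map_eq_zero]
  intro φ hφ
  have h1 : ∀ x : N.Inner → ℝ, φ x = ∑ v, φ (Pi.single v 1) * x v := by
    intro x
    conv_lhs => rw [pi_eq_sum_univ' x]
    simp [mul_comm]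
  have h2 := N.multiplier_eq_zero (lam := fun v => φ (Pi.single v 1)) (fun c => by
    have h3 := LinearMap.congr_fun hφ c
    rw [LinearMap.dualMap_apply, h1] at h3
    exact h3)
  ext v
  exact congrFun h2 v

/-- Hölder's inequality on the pipe; this bound makes `primitive` continuous. -/
theorem abs_primitive_le (g : N.L2) (e : E) (x : Icc (0 : ℝ) (N.len e)) :
    |(N.primitive g).1.1 e x| ≤ (N.len e) ^ (1 / 2 : ℝ) * ‖g‖ := by
  have hi : Integrable (g e) (volume.restrict (Icc (0 : ℝ) (N.len e))) :=
    (Lp.memLp (g e)).integrable (by norm_num)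
  have h1 : (N.primitive g).1.1 e x = ∫ y in (0 : ℝ)..x, g e y := by
    have h := (N.primitive g).2 e x
    rw [primitive_start, zero_add] at h
    rw [h]
    congr 2
    exact congrArg (fun f : N.L2 => (f e : ℝ → ℝ)) (N.dx_primitive g)
  have h2 : |∫ y in (0 : ℝ)..x, g e y| ≤ ∫ y in Icc 0 (N.len e), ‖g e y‖ := by
    rw [intervalIntegral.integral_of_le x.2.1]
    refine (norm_integral_le_integral_norm (fun y => g e y)).trans ?_
    refine setIntegral_mono_set hi.norm (Eventually.of_forall fun y => norm_nonneg _) ?_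
    exact (Ioc_subset_Icc_self.trans (Icc_subset_Icc le_rfl x.2.2)).eventuallyLE
  have h3 : ∫ y in Icc 0 (N.len e), ‖g e y‖ ≤ ‖g e‖ * (N.len e) ^ (1 / 2 : ℝ) := by
    have h4 := eLpNorm_le_eLpNorm_mul_rpow_measure_univ
      (μ := volume.restrict (Icc (0 : ℝ) (N.len e))) (p := 1) (q := 2) (by norm_num)
      (Lp.aestronglyMeasurable (g e))
    have h5 := ENNReal.toReal_mono (ENNReal.mul_ne_top (Lp.eLpNorm_ne_top (g e))
      (ENNReal.rpow_ne_top_of_nonneg (by norm_num) (measure_ne_top _ _))) h4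
    rw [ENNReal.toReal_mul, ← Lp.norm_def, ← ENNReal.toReal_rpow] at h5
    rw [integral_norm_eq_lintegral_enorm hi.1, ← eLpNorm_one_eq_lintegral_enorm]
    refine h5.trans_eq ?_
    rw [Measure.restrict_apply_univ, Real.volume_Icc, sub_zero, ENNReal.toReal_ofReal
      (N.len_pos e).le]
    norm_num
  rw [h1]
  refine h2.trans (h3.trans ?_)
  rw [mul_comm]
  have := N.len_pos e
  gcongr
  exact PiLp.norm_apply_le g e

theorem continuous_primitive : Continuous N.primitive := by
  obtain ⟨C, hC⟩ := Finite.exists_le (fun e => (N.len e) ^ (1 / 2 : ℝ))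
  refine AddMonoidHomClass.continuous_of_bound N.primitive (max C 1) fun g => ?_
  refine max_le ?_ ?_
  · refine (pi_norm_le_iff_of_nonneg (by positivity)).2 fun e => ?_
    refine (ContinuousMap.norm_le _ (by positivity)).2 fun x => ?_
    refine (N.abs_primitive_le g e x).trans ?_
    gcongr
    exact (hC e).trans (le_max_left _ _)
  · change ‖N.dx (N.primitive g)‖ ≤ _
    rw [dx_primitive]
    exact le_mul_of_one_le_left (norm_nonneg _) (le_max_right _ _)

theorem continuous_eval (e : E) (x : Icc (0 : ℝ) (N.len e)) :
    Continuous fun q : N.H1 => q.1.1 e x :=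
  (continuous_eval_const x).comp
    ((continuous_apply e).comp (continuous_fst.comp continuous_subtype_val))

theorem continuous_nsum (v : V) : Continuous fun q : N.H1 => N.nsum q v := by
  refine continuous_finsetSum _ fun e _ => Continuous.sub ?_ ?_
  · split_ifs
    · exact N.continuous_eval e _
    · exact continuous_const
  · split_ifs
    · exact N.continuous_eval e _
    · exact continuous_const

theorem continuous_flux : Continuous N.flux :=
  continuous_pi fun v => N.continuous_nsum v

theorem continuous_toL2 : Continuous N.toL2 := by
  refine (PiLp.continuous_toLp 2 _).comp (continuous_pi fun e => ?_)
  let L : N.H1 →ₗ[ℝ] Lp ℝ 2 (volume.restrict (Icc (0 : ℝ) (N.len e))) :=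
    (PiLp.projₗ 2 _ e) ∘ₗ N.toL2
  refine AddMonoidHomClass.continuous_of_bound L ((volume.restrict (Icc (0 : ℝ) (N.len e))).real
    univ ^ ((2 : ENNReal).toReal)⁻¹) fun q => ?_
  refine Lp.norm_le_of_ae_bound (norm_nonneg _) ?_
  filter_upwards [N.coeFn_toL2 q e] with x hx
  change ‖N.toL2 q e x‖ ≤ _
  rw [hx]
  refine ((q.1.1 e).norm_coe_le_norm _).trans ((norm_le_pi_norm q.1.1 e).trans ?_)
  exact le_max_left _ _

variable {N} in
theorem ContainsIndicators.const_mem {Q : Submodule ℝ N.H1} (h : N.ContainsIndicators Q)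
    (c : E → ℝ) : N.const c ∈ Q := by
  classical
  have h1 : ∀ e, N.const (Pi.single e 1) ∈ Q := by
    intro e
    obtain ⟨q, hq, h1, h2⟩ := h e
    convert hq
    refine N.H1_ext_fst (funext fun e' => ?_)
    ext x
    rw [const_apply]
    by_cases he : e' = e
    · subst he
      rw [h1, Pi.single_eq_same]
    · rw [h2 e' he, Pi.single_eq_of_ne he]
  have h2 : c = ∑ e, c e • Pi.single e (1 : ℝ) := by
    conv_lhs => rw [pi_eq_sum_univ' c]
  rw [h2, map_sum]
  exact Submodule.sum_mem _ fun e _ => by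
    rw [map_smul]
    exact Q.smul_mem _ (h1 e)

/-- There is a bounded right inverse of the derivative that takes values in the functions with
balanced fluxes, respects the approximation spaces, and is bounded from `H⁻¹` to `L²`. -/
theorem exists_potential : ∃ F : N.L2 →L[ℝ] N.L2,
    (∀ (P : Submodule ℝ N.L2) (Q : Submodule ℝ N.H1), N.DerivSurj P Q → N.ContainsIndicators Q →
      ∀ g ∈ P, ∃ ψ ∈ Q, N.toL2 ψ = F g ∧ N.dx ψ = g ∧ N.flux ψ = 0) ∧
    ∀ q : N.H1, N.flux q = 0 → ‖F (N.dx q)‖ ≤ ‖N.toL2 q‖ := by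
  obtain ⟨R, hR⟩ := (N.flux ∘ₗ N.const).exists_rightInverse_of_surjective
    (LinearMap.range_eq_top.2 N.flux_const_surjective)
  -- The edgewise constants selected by `R` cancel the flux imbalance of the primitive without
  -- changing its derivative.
  let S : N.L2 →ₗ[ℝ] N.H1 := N.primitive - N.const ∘ₗ R ∘ₗ N.flux ∘ₗ N.primitive
  have hS : Continuous S := by
    have h1 : Continuous (N.const ∘ₗ R) := LinearMap.continuous_of_finiteDimensional _
    exact N.continuous_primitive.sub (h1.comp (N.continuous_flux.comp N.continuous_primitive))
  have hSdx : ∀ g, N.dx (S g) = g := by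
    intro g
    simp [S, dx_primitive, dx_const]
  have hSflux : ∀ g, N.flux (S g) = 0 := by
    intro g
    have := LinearMap.congr_fun hR (N.flux (N.primitive g))
    simp only [LinearMap.comp_apply, LinearMap.id_apply] at this
    simp [S, this]
  -- `K` is exactly the remaining freedom in a balanced potential. Removing it by projection gives
  -- the potential of least `L²` norm, hence the bound by `‖q‖`.
  let K : Submodule ℝ N.L2 := (LinearMap.ker (N.flux ∘ₗ N.const)).map (N.toL2 ∘ₗ N.const)
  have hK : ∀ q : N.H1, N.dx q = 0 → N.flux q = 0 → N.toL2 q ∈ K := by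
    intro q h1 h2
    rw [N.eq_const_of_dx_eq_zero h1] at h2 ⊢
    exact ⟨_, h2, rfl⟩
  refine ⟨Kᗮ.starProjection ∘L ⟨N.toL2 ∘ₗ S, N.continuous_toL2.comp hS⟩, ?_, ?_⟩
  · intro P Q hPQ hQ g hg
    obtain ⟨r, hr, hrg⟩ : g ∈ Q.map N.dx := by rw [hPQ]; exact hg
    have h1 : S g ∈ Q := by
      -- Two functions with the same derivative differ by edgewise constants, all of which belong to
      -- `Q`; thus a potential built without reference to `Q` lands in it.
      have h2 : S g - r ∈ Q := by
        rw [N.eq_const_of_dx_eq_zero (q := S g - r) (by rw [map_sub, hSdx, hrg, sub_self])]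
        exact hQ.const_mem _
      simpa using Q.add_mem h2 hr
    obtain ⟨c, hc, hcK⟩ : K.starProjection (N.toL2 (S g)) ∈ K := Submodule.starProjection_apply_mem _ _
    refine ⟨S g - N.const c, Q.sub_mem h1 (hQ.const_mem c), ?_, ?_, ?_⟩
    · rw [map_sub]
      rw [LinearMap.comp_apply] at hcK
      rw [hcK]
      simp [Submodule.starProjection_orthogonal]
    · rw [map_sub, hSdx, dx_const, sub_zero]
    · rw [map_sub, hSflux, zero_sub, neg_eq_zero]
      exact hc
  · intro q hq
    have h1 : N.toL2 (S (N.dx q)) = N.toL2 q + N.toL2 (S (N.dx q) - q) := by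
      rw [← map_add, add_sub_cancel]
    have h2 : Kᗮ.starProjection (N.toL2 (S (N.dx q) - q)) = 0 := by
      have := Submodule.starProjection_eq_self_iff.2
        (hK (S (N.dx q) - q) (by rw [map_sub, hSdx, sub_self]) (by rw [map_sub, hSflux, hq, sub_self]))
      rw [Submodule.starProjection_orthogonal, sub_apply, this]
      exact sub_self _
    change ‖Kᗮ.starProjection (N.toL2 (S (N.dx q)))‖ ≤ _
    rw [h1, map_add, h2, add_zero]
    exact Submodule.norm_starProjection_apply_le _ _

end Network

/-! ### Energy dissipation and uniform decay -/

namespace Network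

variable {V E : Type*} [Fintype V] [DecidableEq V] [Fintype E] (N : Network V E)

/-! ### Weak solutions and their energy -/

theorem hasDerivAt_wip (w : E → ℝ) {f g : ℝ → N.L2} {f' g' : N.L2} {t : ℝ}
    (hf : HasDerivAt f f' t) (hg : HasDerivAt g g' t) :
    HasDerivAt (fun s => N.wip w (f s) (g s)) (N.wip w (f t) g' + N.wip w f' (g t)) t := by
  simp only [wip_eq_inner]
  exact ((N.wmul w).hasFDerivAt.comp_hasDerivAt t hf).inner ℝ hg

theorem absolutelyContinuous_wip (w : E → ℝ) {f g : ℝ → N.L2} {s t : ℝ}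
    (hf : AbsolutelyContinuousOnInterval f s t) (hg : AbsolutelyContinuousOnInterval g s t) :
    AbsolutelyContinuousOnInterval (fun s => N.wip w (f s) (g s)) s t := by
  simp only [wip_eq_inner]
  exact (hf.clm_comp (N.wmul w)).inner hg

theorem hasDerivAt_energy {p q : ℝ → N.L2} {p' q' : N.L2} {t : ℝ}
    (hp : HasDerivAt p p' t) (hq : HasDerivAt q q' t) :
    HasDerivAt (fun s => N.energy (p s) (q s)) (N.wip N.a p' (p t) + N.wip N.b q' (q t)) t := by
  have h := ((N.hasDerivAt_wip N.a hp hp).add (N.hasDerivAt_wip N.b hq hq)).const_mul (1 / 2)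
  refine h.congr_deriv ?_
  rw [N.wip_comm N.a (p t), N.wip_comm N.b (q t)]
  ring

theorem absolutelyContinuous_energy {p q : ℝ → N.L2} {s t : ℝ}
    (hp : AbsolutelyContinuousOnInterval p s t) (hq : AbsolutelyContinuousOnInterval q s t) :
    AbsolutelyContinuousOnInterval (fun s => N.energy (p s) (q s)) s t :=
  ((N.absolutelyContinuous_wip N.a hp hp).fun_add
    (N.absolutelyContinuous_wip N.b hq hq)).const_mul _

/-- The equations between a state `(p, q)` with balanced fluxes and its velocity `(p', q')`, tested
in the approximation spaces with balanced fluxes, so that the multipliers do not appear. -/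
structure WeakEquations (P : Submodule ℝ N.L2) (Q : Submodule ℝ N.H1) (u : N.Port → ℝ)
    (p : N.L2) (q : N.H1) (p' q' : N.L2) : Prop where
  p_mem : p ∈ P
  q_mem : q ∈ Q
  flux_eq : N.flux q = 0
  mass_eq : ∀ φ ∈ P, N.wip N.a p' φ + inner ℝ (N.dx q) φ = 0
  momentum_eq : ∀ ψ ∈ Q, N.flux ψ = 0 →
    N.wip N.b q' (N.toL2 ψ) - inner ℝ p (N.dx ψ) + N.wip N.d (N.toL2 q) (N.toL2 ψ)
      = - ∑ v : N.Port, u v * N.nsum ψ v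

/-- Absolutely continuous functions that satisfy the weak equations almost everywhere. -/
structure IsWeakSolution (P : Submodule ℝ N.L2) (Q : Submodule ℝ N.H1) (T : ℝ)
    (u : ℝ → N.Port → ℝ) (p : ℝ → N.L2) (q : ℝ → N.H1) : Prop where
  p_ac : AbsolutelyContinuousOnInterval p 0 T
  q_ac : AbsolutelyContinuousOnInterval (fun t => N.toL2 (q t)) 0 T
  eqs : ∀ᵐ t, t ∈ Icc 0 T → ∃ p' q', HasDerivAt p p' t ∧ HasDerivAt (fun s => N.toL2 (q s)) q' t ∧
    N.WeakEquations P Q (u t) (p t) (q t) p' q'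

variable {N}

/-- The state is an admissible test function for its own equations, and the two pairings of `p` with
`∂ₓ' q` cancel. -/
theorem WeakEquations.energy_rate {P : Submodule ℝ N.L2} {Q : Submodule ℝ N.H1} {u : N.Port → ℝ}
    {p : N.L2} {q : N.H1} {p' q' : N.L2} (h : N.WeakEquations P Q u p q p' q') :
    N.wip N.a p' p + N.wip N.b q' (N.toL2 q)
      = - N.wip N.d (N.toL2 q) (N.toL2 q) + ∑ v : N.Port, N.output q v * u v := by
  have h1 := h.mass_eq p h.p_mem
  have h2 := h.momentum_eq q h.q_mem h.flux_eq
  have h3 : ∑ v : N.Port, N.output q v * u v = - ∑ v : N.Port, u v * N.nsum q v := by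
    rw [← Finset.sum_neg_distrib]
    exact Finset.sum_congr rfl fun v _ => by rw [output]; ring
  rw [real_inner_comm] at h2
  rw [h3, ← h2]
  rw [real_inner_comm] at h1
  linarith [real_inner_comm p (N.dx q)]

/-- The choice of the parameters in the modified energy. -/
theorem lyapunov_rate_le {c₀ c₁ m ε e w w₁ w₂ w₃ w₄ w₅ x y : ℝ} (hc₀ : 0 < c₀) (hc₁ : 0 < c₁)
    (hε0 : 0 < ε) (hε1 : ε ≤ 1) (hεq : ε * (c₁ + (c₁ * m) ^ 2 / (2 * c₀)) ≤ c₀ / 2)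
    (hψ : w₂ - w₅ + w₃ = 0) (h1 : -w₁ ≤ c₁ * y * y) (h3 : w₃ ≤ c₁ * y * (m * x))
    (hA : c₀ * x ^ 2 ≤ w₅) (hD : c₀ * y ^ 2 ≤ w₄) (hE : e ≤ c₁ / 2 * (x ^ 2 + y ^ 2))
    (hb : -(1 / 2 * e) ≤ ε * w) :
    -w₄ - (ε * w₁ + ε * w₂) ≤ -(ε * c₀ / 2 / c₁) * (e - ε * w) := by
  -- In the application `x = ‖p‖` and `y = ‖q‖`. Young's inequality is weighted so that half of the
  -- damping `c₀ x²` survives.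
  have hyoung : c₁ * y * (m * x) ≤ c₀ / 2 * x ^ 2 + (c₁ * m) ^ 2 / (2 * c₀) * y ^ 2 := by
    have h4 : c₀ / 2 * x ^ 2 + (c₁ * m) ^ 2 / (2 * c₀) * y ^ 2 - c₁ * y * (m * x)
        = (c₀ * x - c₁ * m * y) ^ 2 / (2 * c₀) := by
      field_simp
      ring
    have h5 : 0 ≤ (c₀ * x - c₁ * m * y) ^ 2 / (2 * c₀) := by positivity
    linarith
  have hleft : -w₄ - (ε * w₁ + ε * w₂) ≤ -(ε * c₀ / 2) * (x ^ 2 + y ^ 2) := by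
    have h6 : -(w₁ + w₂) ≤ (c₁ + (c₁ * m) ^ 2 / (2 * c₀)) * y ^ 2 - c₀ / 2 * x ^ 2 := by linarith
    have h7 := mul_le_mul_of_nonneg_left h6 hε0.le
    have h8 := mul_le_mul_of_nonneg_right hεq (sq_nonneg y)
    have h9 : ε * c₀ / 2 * y ^ 2 ≤ c₀ / 2 * y ^ 2 :=
      mul_le_mul_of_nonneg_right (by nlinarith) (sq_nonneg y)
    linarith
  refine hleft.trans ?_
  have h10 : e - ε * w ≤ c₁ * (x ^ 2 + y ^ 2) := by nlinarith [sq_nonneg x, sq_nonneg y]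
  have h11 : ε * c₀ / 2 / c₁ * (e - ε * w) ≤ ε * c₀ / 2 / c₁ * (c₁ * (x ^ 2 + y ^ 2)) :=
    mul_le_mul_of_nonneg_left h10 (by positivity)
  have h12 : ε * c₀ / 2 / c₁ * (c₁ * (x ^ 2 + y ^ 2)) = ε * c₀ / 2 * (x ^ 2 + y ^ 2) := by
    field_simp
  linarith

variable (N) in
/-- The energy is modified by a small multiple of a mixed term, uniformly in the approximation
spaces, so that it decays exponentially. -/
theorem exists_lyapunov : ∃ γ : ℝ, 0 < γ ∧
    ∀ (P : Submodule ℝ N.L2) (Q : Submodule ℝ N.H1) [P.HasOrthogonalProjection],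
      N.DerivSurj P Q → N.ContainsIndicators Q → ∃ M : N.L2 →L[ℝ] N.L2,
        (∀ p q, |N.wip N.b q (M p)| ≤ 1 / 2 * N.energy p q) ∧
        ∀ p q p' q', N.WeakEquations P Q 0 p q p' q' →
          - N.wip N.d (N.toL2 q) (N.toL2 q) - (N.wip N.b (N.toL2 q) (M p') + N.wip N.b q' (M p))
            ≤ -γ * (N.energy p (N.toL2 q) - N.wip N.b (N.toL2 q) (M p)) := by
  obtain ⟨c₀, c₁, hc₀, hc₀₁, hc⟩ := N.exists_coeff_bounds
  obtain ⟨F, hF, hF'⟩ := N.exists_potential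
  have hc₁ : 0 < c₁ := hc₀.trans_le hc₀₁
  set m : ℝ := ‖F‖ * c₁ with hm
  have hm0 : 0 ≤ m := by positivity
  -- With `ε k = c₀ / 2`, the summand `c₀` gives `ε ≤ 1`, the summand `c₁ m` keeps the mixed term
  -- below half the energy, and the other two let the dissipation of `q` absorb the error terms.
  set k : ℝ := c₀ + c₁ + c₁ * m + (c₁ * m) ^ 2 / (2 * c₀) with hk
  have hk0 : 0 < k := by positivity
  set ε : ℝ := c₀ / 2 / k with hε
  have hε0 : 0 < ε := by positivity
  have hεk : ε * k = c₀ / 2 := div_mul_cancel₀ _ hk0.ne'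
  have hsq : 0 ≤ (c₁ * m) ^ 2 / (2 * c₀) := by positivity
  have hε1 : ε ≤ 1 := by
    have : ε * c₀ ≤ ε * k := mul_le_mul_of_nonneg_left (by nlinarith) hε0.le
    nlinarith
  have hεm : ε * (c₁ * m) ≤ c₀ / 2 := by
    rw [← hεk]; exact mul_le_mul_of_nonneg_left (by nlinarith) hε0.le
  have hεq : ε * (c₁ + (c₁ * m) ^ 2 / (2 * c₀)) ≤ c₀ / 2 := by
    rw [← hεk]; exact mul_le_mul_of_nonneg_left (by nlinarith) hε0.le
  have hlow : ∀ p q : N.L2, c₀ / 2 * (‖p‖ ^ 2 + ‖q‖ ^ 2) ≤ N.energy p q := by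
    intro p q
    have h1 := N.mul_norm_sq_le_wip (fun e => (hc e).1.1) p
    have h2 := N.mul_norm_sq_le_wip (fun e => (hc e).2.1.1) q
    rw [energy]
    linarith
  have hup : ∀ p q : N.L2, N.energy p q ≤ c₁ / 2 * (‖p‖ ^ 2 + ‖q‖ ^ 2) := by
    intro p q
    have h1 := (le_abs_self _).trans (N.abs_wip_le hc₁.le (fun e => (hc e).1.2) p p)
    have h2 := (le_abs_self _).trans (N.abs_wip_le hc₁.le (fun e => (hc e).2.1.2) q q)
    rw [energy]
    linarith
  refine ⟨ε * c₀ / 2 / c₁, by positivity, fun P Q _ hPQ hQ => ?_⟩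
  -- Since `a p` need not lie in `P`, it is projected before a potential is taken; pairing with `p ∈
  -- P` does not see the difference.
  let G : N.L2 →L[ℝ] N.L2 := P.starProjection ∘L N.wmul N.a
  have hG : ∀ p, ‖F (G p)‖ ≤ m * ‖p‖ := by
    intro p
    rw [hm, mul_assoc]
    refine (F.le_opNorm _).trans (mul_le_mul_of_nonneg_left ?_ (norm_nonneg _))
    exact (P.norm_starProjection_apply_le _).trans
      (N.norm_wmul_le hc₁.le (fun e => (hc e).1.2) p)
  have hM : ∀ p q, N.wip N.b q ((ε • (F ∘L G)) p) = ε * N.wip N.b q (F (G p)) := by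
    intro p q
    simp [wip_eq_inner, inner_smul_right]
  have hbound : ∀ p q, |N.wip N.b q ((ε • (F ∘L G)) p)| ≤ 1 / 2 * N.energy p q := by
    intro p q
    have h1 := N.abs_wip_le hc₁.le (fun e => (hc e).2.1.2) q (F (G p))
    have h2 : c₁ * ‖q‖ * ‖F (G p)‖ ≤ c₁ * ‖q‖ * (m * ‖p‖) :=
      mul_le_mul_of_nonneg_left (hG p) (by positivity)
    have h3 : ε * |N.wip N.b q (F (G p))| ≤ ε * (c₁ * m) * (‖q‖ * ‖p‖) :=
      (mul_le_mul_of_nonneg_left (h1.trans h2) hε0.le).trans_eq (by ring)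
    have h4 : ε * (c₁ * m) * (‖q‖ * ‖p‖) ≤ c₀ / 2 * (‖q‖ * ‖p‖) :=
      mul_le_mul_of_nonneg_right hεm (by positivity)
    have h5 : ‖q‖ * ‖p‖ ≤ (‖p‖ ^ 2 + ‖q‖ ^ 2) / 2 := by nlinarith [sq_nonneg (‖p‖ - ‖q‖)]
    have h6 : c₀ / 2 * (‖q‖ * ‖p‖) ≤ c₀ / 2 * ((‖p‖ ^ 2 + ‖q‖ ^ 2) / 2) :=
      mul_le_mul_of_nonneg_left h5 (by positivity)
    rw [hM, abs_mul, abs_of_pos hε0]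
    linarith [hlow p q]
  refine ⟨ε • (F ∘L G), hbound, fun p q p' q' h => ?_⟩
  have hpP : P.starProjection p = p := Submodule.starProjection_eq_self_iff.2 h.p_mem
  have hdxP : N.dx q ∈ P := by rw [← hPQ]; exact ⟨q, h.q_mem, rfl⟩
  have hGp : inner ℝ p (G p) = N.wip N.a p p := by
    change inner ℝ p (P.starProjection (N.wmul N.a p)) = _
    rw [← Submodule.inner_starProjection_left_eq_right, hpP, wip_eq_inner, real_inner_comm]
  -- The mass equation only holds against `P`, but `∂ₓ' q` already lies in `P`, so after projection
  -- it becomes an identity.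
  have hGp' : G p' = - N.dx q := by
    have h1 : P.starProjection (N.wmul N.a p' + N.dx q) = 0 := by
      rw [Submodule.starProjection_apply_eq_zero_iff, Submodule.mem_orthogonal']
      intro φ hφ
      rw [inner_add_left, ← wip_eq_inner]
      exact h.mass_eq φ hφ
    rw [map_add, Submodule.starProjection_eq_self_iff.2 hdxP] at h1
    exact eq_neg_of_add_eq_zero_left h1
  obtain ⟨ψ, hψQ, hψF, hψd, hψf⟩ := hF P Q hPQ hQ (G p) (Submodule.starProjection_apply_mem _ _)
  have hψ := h.momentum_eq ψ hψQ hψf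
  simp only [hψF, hψd, hGp, Pi.zero_apply, zero_mul, Finset.sum_const_zero, neg_zero] at hψ
  have hB1 := N.abs_wip_le hc₁.le (fun e => (hc e).2.1.2) (N.toL2 q) (F (G p'))
  have hB1' : ‖F (G p')‖ ≤ ‖N.toL2 q‖ := by
    rw [hGp', map_neg, norm_neg]
    exact hF' q h.flux_eq
  have hB2 := N.abs_wip_le hc₁.le (fun e => (hc e).2.2.2) (N.toL2 q) (F (G p))
  have hA := N.mul_norm_sq_le_wip (fun e => (hc e).1.1) p
  have hD := N.mul_norm_sq_le_wip (fun e => (hc e).2.2.1) (N.toL2 q)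
  have hb := neg_le_of_abs_le (hbound p (N.toL2 q))
  rw [hM] at hb
  rw [hM, hM, hM]
  refine lyapunov_rate_le hc₀ hc₁ hε0 hε1 hεq hψ ((neg_le_abs _).trans
    (hB1.trans (mul_le_mul_of_nonneg_left hB1' (by positivity)))) ((le_abs_self _).trans
    (hB2.trans (mul_le_mul_of_nonneg_left (hG p) (by positivity)))) hA hD (hup p (N.toL2 q)) hb

variable (N) in
/-- Weak solutions decay exponentially while the input vanishes, uniformly in the approximation
spaces. -/
theorem exists_decay : ∃ γ : ℝ, 0 < γ ∧
    ∀ (P : Submodule ℝ N.L2) (Q : Submodule ℝ N.H1) [P.HasOrthogonalProjection],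
      N.DerivSurj P Q → N.ContainsIndicators Q →
      ∀ (T : ℝ) (u : ℝ → N.Port → ℝ) (p : ℝ → N.L2) (q : ℝ → N.H1), N.IsWeakSolution P Q T u p q →
      ∀ s t, 0 ≤ s → s ≤ t → t ≤ T → (∀ r ∈ Icc s t, u r = 0) →
        N.energy (p t) (N.toL2 (q t))
          ≤ 3 * Real.exp (-γ * (t - s)) * N.energy (p s) (N.toL2 (q s)) := by
  obtain ⟨γ, hγ, h⟩ := N.exists_lyapunov
  refine ⟨γ, hγ, fun P Q _ hPQ hQ T u p q hsol s t hs hst ht hu => ?_⟩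
  obtain ⟨M, hM, hd⟩ := h P Q hPQ hQ
  have hsub : uIcc s t ⊆ uIcc 0 T := by
    rw [uIcc_of_le hst, uIcc_of_le (hs.trans (hst.trans ht))]
    exact Icc_subset_Icc hs ht
  have hac : AbsolutelyContinuousOnInterval (fun r => N.energy (p r) (N.toL2 (q r))
      - N.wip N.b (N.toL2 (q r)) (M (p r))) s t :=
    ((N.absolutelyContinuous_energy hsol.p_ac hsol.q_ac).fun_sub
      (N.absolutelyContinuous_wip N.b hsol.q_ac (hsol.p_ac.clm_comp M))).mono hsub
  have hexp := hac.le_exp_mul_of_ae_deriv_le (γ := γ) hst (by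
    filter_upwards [hsol.eqs] with r hr hm
    obtain ⟨p', q', hp', hq', heq⟩ := hr ⟨hs.trans hm.1, hm.2.trans ht⟩
    refine ⟨_, (N.hasDerivAt_energy hp' hq').fun_sub
      (N.hasDerivAt_wip N.b hq' (M.hasFDerivAt.comp_hasDerivAt r hp')), ?_⟩
    rw [heq.energy_rate]
    rw [hu r hm] at heq ⊢
    have := hd _ _ _ _ heq
    simpa using this)
  -- The modified energy lies between `1/2` and `3/2` of the energy; the ratio is the factor `3`.
  have h1 := abs_le.1 (hM (p t) (N.toL2 (q t)))
  have h2 := abs_le.1 (hM (p s) (N.toL2 (q s)))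
  have h3 : N.energy (p s) (N.toL2 (q s)) - N.wip N.b (N.toL2 (q s)) (M (p s))
      ≤ 3 / 2 * N.energy (p s) (N.toL2 (q s)) := by linarith
  have h4 := mul_le_mul_of_nonneg_left h3 (Real.exp_pos (-γ * (t - s))).le
  linarith

end Network

namespace Network

variable {V E : Type*} [Fintype V] [DecidableEq V] [Fintype E] {N : Network V E}

/-! ### Classical solutions are weak solutions -/

/-- After integration by parts, continuity of the pressure turns the boundary terms into fluxes of
the test function weighted by vertex pressures; only the ports remain for balanced test functions.
-/
theorem IsClassicalSolution.isWeakSolution {T : ℝ} (hT : 0 < T) {u : ℝ → N.Port → ℝ}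
    {p q : ℝ → N.H1} (h : N.IsClassicalSolution T u p q) :
    N.IsWeakSolution ⊤ ⊤ T u (fun t => N.toL2 (p t)) q := by
  refine ⟨?_, ?_, ?_⟩
  · exact ContDiffOn.absolutelyContinuousOnInterval (by rw [uIcc_of_le hT.le]; exact h.p_diff)
  · exact ContDiffOn.absolutelyContinuousOnInterval (by rw [uIcc_of_le hT.le]; exact h.q_diff)
  -- Away from the null set of endpoints, derivatives within the interval are ordinary derivatives.
  have h0 : ∀ᵐ t : ℝ, t ≠ 0 := by simp [ae_iff, measure_singleton]
  have h1 : ∀ᵐ t : ℝ, t ≠ T := by simp [ae_iff, measure_singleton]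
  filter_upwards [h0, h1] with t ht0 ht1 ht
  have hnhds : Icc 0 T ∈ 𝓝 t :=
    Icc_mem_nhds (lt_of_le_of_ne ht.1 ht0.symm) (lt_of_le_of_ne ht.2 ht1)
  refine ⟨_, _, ((h.p_diff.differentiableOn one_ne_zero t ht).hasDerivWithinAt).hasDerivAt hnhds,
    ((h.q_diff.differentiableOn one_ne_zero t ht).hasDerivWithinAt).hasDerivAt hnhds,
    trivial, trivial, funext fun v => h.flux_balance t ht v, fun φ _ => ?_, fun ψ _ hψ => ?_⟩
  · rw [wip, PiLp.inner_apply, ← Finset.sum_add_distrib]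
    refine Finset.sum_eq_zero fun e _ => ?_
    rw [← real_inner_smul_left, ← inner_add_left, h.mass_eq t ht e, inner_zero_left]
  · obtain ⟨π, hπ, hπu⟩ := h.pressure t ht
    have h2 : N.wip N.b (derivWithin (fun s => N.toL2 (q s)) (Icc 0 T) t) (N.toL2 ψ)
        + inner ℝ (N.dx (p t)) (N.toL2 ψ) + N.wip N.d (N.toL2 (q t)) (N.toL2 ψ) = 0 := by
      rw [wip, wip, PiLp.inner_apply, ← Finset.sum_add_distrib, ← Finset.sum_add_distrib]
      refine Finset.sum_eq_zero fun e _ => ?_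
      rw [← real_inner_smul_left, ← real_inner_smul_left, ← inner_add_left, ← inner_add_left,
        h.momentum_eq t ht e, inner_zero_left]
    have h3 := N.inner_dx_add_inner_dx (p t) ψ
    simp only [(hπ _).1, (hπ _).2] at h3
    rw [← N.sum_mul_nsum, N.sum_eq_sum_inner_add_sum_port] at h3
    have h4 : ∀ v : N.Inner, N.nsum ψ v = 0 := fun v => congrFun hψ v
    simp only [h4, hπu, mul_zero, Finset.sum_const_zero, zero_add] at h3
    rw [← h3]
    linarith

variable (N) in
theorem derivSurj_top : N.DerivSurj ⊤ ⊤ :=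
  eq_top_iff.2 fun g _ => ⟨N.primitive g, trivial, N.dx_primitive g⟩

variable (N) in
theorem containsIndicators_top : N.ContainsIndicators ⊤ := by
  classical
  refine fun e => ⟨N.const (Pi.single e 1), trivial, fun x => ?_, fun e' he x => ?_⟩
  · rw [const_apply, Pi.single_eq_same]
  · rw [const_apply, Pi.single_eq_of_ne he]

/-! ### Galerkin solutions are weak solutions -/

/-! ### Sobolev functions of time -/

section MemH1Time

variable {X : Type*} [NormedAddCommGroup X] [NormedSpace ℝ X] {T : ℝ} {w : ℝ → X}

omit [NormedSpace ℝ X] in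
theorem intervalIntegrable_of_memLp_two {w' : ℝ → X} (hT : 0 ≤ T)
    (h : MemLp w' 2 (volume.restrict (Icc 0 T))) : IntervalIntegrable w' volume 0 T := by
  rw [intervalIntegrable_iff_integrableOn_Icc_of_le hT]
  exact h.integrable (by norm_num)

theorem MemH1Time.absolutelyContinuous (hT : 0 ≤ T) (h : MemH1Time T w) :
    AbsolutelyContinuousOnInterval w 0 T := by
  obtain ⟨w', hw', hw⟩ := h
  exact .of_eq_add_integral hT (intervalIntegrable_of_memLp_two hT hw') hw

theorem MemH1Time.ae_hasDerivAt [CompleteSpace X] (hT : 0 ≤ T) (h : MemH1Time T w) :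
    ∀ᵐ t, t ∈ Icc 0 T → HasDerivAt w (deriv w t) t := by
  obtain ⟨w', hw', hw⟩ := h
  have h0 : ∀ᵐ t : ℝ, t ≠ 0 := by simp [ae_iff, measure_singleton]
  have h1 : ∀ᵐ t : ℝ, t ≠ T := by simp [ae_iff, measure_singleton]
  filter_upwards [(intervalIntegrable_of_memLp_two hT hw').ae_hasDerivAt_integral, h0, h1]
    with t ht ht0 ht1 hm
  have hd := (ht (by rwa [uIcc_of_le hT]) 0 left_mem_uIcc).const_add (w 0)
  refine (hd.congr_of_eventuallyEq ?_).differentiableAt.hasDerivAt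
  filter_upwards [Icc_mem_nhds (lt_of_le_of_ne hm.1 ht0.symm) (lt_of_le_of_ne hm.2 ht1)]
    with s hs using hw s hs

theorem MemH1Time.ae_hasDerivAt_clm_comp [CompleteSpace X] {Y : Type*} [NormedAddCommGroup Y]
    [NormedSpace ℝ Y] (L : X →L[ℝ] Y) (hT : 0 ≤ T) (h : MemH1Time T w) :
    ∀ᵐ t, t ∈ Icc 0 T → HasDerivAt (fun s => L (w s)) (L (deriv w t)) t := by
  filter_upwards [h.ae_hasDerivAt hT] with t ht hm
  exact L.hasFDerivAt.comp_hasDerivAt t (ht hm)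

end MemH1Time

section Subspace

variable {X Y : Type*} [NormedAddCommGroup X] [NormedSpace ℝ X] [NormedAddCommGroup Y]
  [NormedSpace ℝ Y] {S : Submodule ℝ X} [FiniteDimensional ℝ S]

omit [FiniteDimensional ℝ S] in
theorem MemH1Time.absolutelyContinuous_comp (L : X →L[ℝ] Y) {T : ℝ} {w : ℝ → S} (hT : 0 ≤ T)
    (h : MemH1Time T w) : AbsolutelyContinuousOnInterval (fun t => L (w t)) 0 T :=
  (h.absolutelyContinuous hT).clm_comp (L ∘L S.subtypeL)

theorem MemH1Time.ae_hasDerivAt_comp (L : X →L[ℝ] Y) {T : ℝ} {w : ℝ → S} (hT : 0 ≤ T)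
    (h : MemH1Time T w) :
    ∀ᵐ t, t ∈ Icc 0 T → HasDerivAt (fun s => L (w s)) (L (deriv w t : S)) t :=
  have : CompleteSpace S := FiniteDimensional.complete ℝ S
  h.ae_hasDerivAt_clm_comp (L ∘L S.subtypeL) hT

/-- An injective linear map on a finite-dimensional space is a closed embedding. -/
theorem tendsto_of_tendsto_injective (L : X →L[ℝ] Y) (hL : Function.Injective L) {ι : Type*}
    {l : Filter ι} {w : ι → S} {x : S} (h : Tendsto (fun i => L (w i)) l (𝓝 (L x))) :
    Tendsto w l (𝓝 x) := by
  have hinj : Function.Injective (L.toLinearMap ∘ₗ S.subtype) := hL.comp Subtype.val_injective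
  exact (LinearMap.isClosedEmbedding_of_injective
    (LinearMap.ker_eq_bot.2 hinj)).isEmbedding.tendsto_nhds_iff.2 h

end Subspace

variable {P : Submodule ℝ N.L2} {Q : Submodule ℝ N.H1}

variable (N) in
/-- The bounded embedding `H¹ → L²`. -/
noncomputable def toL2L : N.H1 →L[ℝ] N.L2 := ⟨N.toL2, N.continuous_toL2⟩

theorem IsGalerkinSolution.flux_eq {T : ℝ} {p₀ q₀ : N.L2} {u : ℝ → N.Port → ℝ} {p : ℝ → P}
    {q : ℝ → Q} {lam : ℝ → N.Inner → ℝ} (h : N.IsGalerkinSolution P Q T p₀ q₀ u p q lam)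
    {t : ℝ} (ht : t ∈ Icc 0 T) : N.flux (q t) = 0 := by
  classical
  funext v
  simpa [flux_apply, Pi.single_apply] using h.flux_balance t ht (Pi.single v 1)

theorem MemH1Time.absolutelyContinuous_toL2 {T : ℝ} (hT : 0 ≤ T) {q : ℝ → Q}
    (h : MemH1Time T q) : AbsolutelyContinuousOnInterval (fun t => N.toL2 (q t)) 0 T := by
  have h1 := MemH1Time.absolutelyContinuous_comp (X := N.H1) (S := Q) (w := q) N.toL2L hT h
  exact h1

theorem MemH1Time.ae_hasDerivAt_toL2 [FiniteDimensional ℝ Q] {T : ℝ} (hT : 0 ≤ T) {q : ℝ → Q}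
    (h : MemH1Time T q) : ∀ᵐ t, t ∈ Icc 0 T →
      HasDerivAt (fun s => N.toL2 (q s)) (N.toL2 (deriv q t : Q)) t := by
  have h1 := @MemH1Time.ae_hasDerivAt_comp N.H1 N.L2 _ _ _ _ Q _ N.toL2L T q hT h
  exact h1

theorem IsGalerkinSolution.isWeakSolution [FiniteDimensional ℝ P] [FiniteDimensional ℝ Q]
    {T : ℝ} (hT : 0 ≤ T) {p₀ q₀ : N.L2} {u : ℝ → N.Port → ℝ} {p : ℝ → P} {q : ℝ → Q}
    {lam : ℝ → N.Inner → ℝ} (h : N.IsGalerkinSolution P Q T p₀ q₀ u p q lam) :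
    N.IsWeakSolution P Q T u (fun t => p t) (fun t => q t) := by
  have hdp := h.p_mem.ae_hasDerivAt_comp (ContinuousLinearMap.id ℝ N.L2) hT
  have hdq := h.q_mem.ae_hasDerivAt_toL2 hT
  refine ⟨h.p_mem.absolutelyContinuous_comp (ContinuousLinearMap.id ℝ N.L2) hT,
    h.q_mem.absolutelyContinuous_toL2 hT, ?_⟩
  filter_upwards [hdp, hdq,
    (ae_restrict_iff' measurableSet_Icc).1 h.mass_eq,
    (ae_restrict_iff' measurableSet_Icc).1 h.momentum_eq] with t hp hq h1 h2 ht
  refine ⟨_, _, hp ht, hq ht, (p t).2, (q t).2, h.flux_eq ht, h1 ht, fun ψ hψ hf => ?_⟩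
  have h3 := h2 ht ψ hψ
  have h4 : ∀ v : N.Inner, N.nsum ψ v = 0 := fun v => congrFun hf v
  simp only [h4, mul_zero, Finset.sum_const_zero, add_zero] at h3
  exact h3

theorem IsGalerkinSolution.continuousOn_output {T : ℝ} (hT : 0 ≤ T) {p₀ q₀ : N.L2}
    {u : ℝ → N.Port → ℝ} {p : ℝ → P} {q : ℝ → Q} {lam : ℝ → N.Inner → ℝ}
    (h : N.IsGalerkinSolution P Q T p₀ q₀ u p q lam) (v : N.Port) :
    ContinuousOn (fun t => N.output (q t) v) (Icc 0 T) := by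
  have hq := (h.q_mem.absolutelyContinuous hT).continuousOn
  rw [uIcc_of_le hT] at hq
  exact (((N.continuous_nsum v).comp continuous_subtype_val).comp_continuousOn hq).neg

/-! ### Balance laws for mass and energy -/

theorem ContainsOne.toL2_const_mem (h : N.ContainsOne P) : N.toL2 (N.const 1) ∈ P := by
  obtain ⟨p, hp, h1⟩ := h
  convert hp
  ext1 e
  refine Lp.ext ?_
  filter_upwards [N.coeFn_toL2_const 1 e, h1 e] with x hx hx'
  rw [hx, hx', Pi.one_apply]

/-- Testing with `1` leaves the sum of all vertex fluxes, of which only the ports contribute. The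
outputs are continuous in time, so the almost everywhere identity holds at every time. -/
theorem massConservation [FiniteDimensional ℝ P] [FiniteDimensional ℝ Q] (hP : N.ContainsOne P) :
    N.MassConservation P Q := by
  intro T hT p₀ q₀ u p q lam h t ht
  have hw := h.isWeakSolution hT.le
  have hconst : AbsolutelyContinuousOnInterval (fun _ : ℝ => N.toL2 (N.const 1)) 0 T :=
    contDiffOn_const.absolutelyContinuousOnInterval
  simp only [mass_eq_wip]
  refine (N.absolutelyContinuous_wip N.a hw.p_ac hconst).hasDerivWithinAt_of_ae
    (g := fun t => ∑ v : N.Port, N.output (q t) v)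
    (continuousOn_finsetSum _ fun v _ => h.continuousOn_output hT.le v) ?_ ht
  filter_upwards [hw.eqs] with s hs hm
  obtain ⟨p', q', hp', -, heq⟩ := hs hm
  refine (N.hasDerivAt_wip N.a hp' (hasDerivAt_const s _)).congr_deriv ?_
  have h1 := heq.mass_eq _ hP.toL2_const_mem
  rw [inner_dx_const] at h1
  have h2 := N.sum_mul_nsum 1 (q s)
  rw [N.sum_eq_sum_inner_add_sum_port] at h2
  have h3 : ∀ v : N.Inner, N.nsum (q s) v = 0 := fun v => congrFun heq.flux_eq v
  simp only [h3, Pi.one_apply, one_mul, Finset.sum_const_zero, zero_add] at h1 h2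
  rw [← h2] at h1
  simp only [output, Finset.sum_neg_distrib, wip_eq_inner, inner_zero_right, zero_add] at h1 ⊢
  linarith

theorem energyBalance [FiniteDimensional ℝ P] [FiniteDimensional ℝ Q] : N.EnergyBalance P Q := by
  intro T hT p₀ q₀ u p q lam h
  have hw := h.isWeakSolution hT.le
  have hac := N.absolutelyContinuous_energy hw.p_ac hw.q_ac
  have hae : ∀ᵐ t, t ∈ Icc 0 T → HasDerivAt (fun s => N.energy (p s) (N.toL2 (q s)))
      (- N.wip N.d (N.toL2 (q t)) (N.toL2 (q t)) + ∑ v : N.Port, N.output (q t) v * u t v) t := by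
    filter_upwards [hw.eqs] with t ht hm
    obtain ⟨p', q', hp', hq', heq⟩ := ht hm
    exact heq.energy_rate ▸ N.hasDerivAt_energy hp' hq'
  refine ⟨hac, (ae_restrict_iff' measurableSet_Icc).2 hae, fun hu t ht => ?_⟩
  refine hac.hasDerivWithinAt_of_ae (g := fun t => - N.wip N.d (N.toL2 (q t)) (N.toL2 (q t))
    + ∑ v : N.Port, N.output (q t) v * u t v) ?_ hae ht
  have hd := (N.absolutelyContinuous_wip N.d hw.q_ac hw.q_ac).continuousOn
  rw [uIcc_of_le hT.le] at hd
  exact hd.neg.add (continuousOn_finsetSum _ fun v _ =>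
    (h.continuousOn_output hT.le v).mul (continuousOn_pi.1 hu v))

/-! ### Steady states -/

theorem surjective_of_injective_of_finrank_dual {X : Type*} [AddCommGroup X] [Module ℝ X]
    [FiniteDimensional ℝ X] (f : X →ₗ[ℝ] X →ₗ[ℝ] ℝ) (hf : Function.Injective f) :
    Function.Surjective f :=
  (LinearMap.injective_iff_surjective_of_finrank_eq_finrank
    (Subspace.dual_finrank_eq (K := ℝ) (V := X)).symm).1 hf

variable (P Q) in
/-- The bilinear form of the stationary system. -/
noncomputable def steadyForm : (P × Q × (N.Inner → ℝ)) →ₗ[ℝ] (P × Q × (N.Inner → ℝ)) →ₗ[ℝ] ℝ :=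
  LinearMap.mk₂ ℝ (fun x y => inner ℝ (N.dx x.2.1) (y.1 : N.L2)
      + (- inner ℝ (x.1 : N.L2) (N.dx y.2.1) + inner ℝ (N.wmul N.d (N.toL2 x.2.1)) (N.toL2 y.2.1)
        + ∑ v : N.Inner, x.2.2 v * N.nsum y.2.1 v) + ∑ v : N.Inner, N.nsum x.2.1 v * y.2.2 v)
    (fun x x' y => by
      simp only [Prod.fst_add, Prod.snd_add, Submodule.coe_add, map_add, inner_add_left, nsum_add,
        Pi.add_apply, add_mul, Finset.sum_add_distrib]
      ring)
    (fun c x y => by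
      simp only [Prod.smul_fst, Prod.smul_snd, Submodule.coe_smul, map_smul, real_inner_smul_left,
        nsum_smul, Pi.smul_apply, smul_eq_mul, mul_assoc, ← Finset.mul_sum]
      ring)
    (fun x y y' => by
      simp only [Prod.fst_add, Prod.snd_add, Submodule.coe_add, map_add, inner_add_right, nsum_add,
        Pi.add_apply, mul_add, Finset.sum_add_distrib]
      ring)
    (fun c x y => by
      simp only [Prod.smul_fst, Prod.smul_snd, Submodule.coe_smul, map_smul, real_inner_smul_right,
        nsum_smul, Pi.smul_apply, smul_eq_mul, mul_left_comm _ c, ← Finset.mul_sum]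
      ring)

variable (P Q) in
/-- The functional of the stationary system. -/
noncomputable def steadyLoad (u : N.Port → ℝ) : (P × Q × (N.Inner → ℝ)) →ₗ[ℝ] ℝ where
  toFun y := - ∑ v : N.Port, u v * N.nsum y.2.1 v
  map_add' y y' := by
    simp only [Prod.fst_add, Prod.snd_add, Submodule.coe_add, nsum_add, mul_add,
      Finset.sum_add_distrib]
    ring
  map_smul' c y := by
    simp only [Prod.smul_fst, Prod.smul_snd, Submodule.coe_smul, nsum_smul, mul_left_comm _ c,
      ← Finset.mul_sum, RingHom.id_apply, smul_eq_mul]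
    ring

theorem isSteadyState_iff {u : N.Port → ℝ} {p : P} {q : Q} {lam : N.Inner → ℝ} :
    N.IsSteadyState P Q u p q lam ↔ steadyForm P Q (p, q, lam) = steadyLoad P Q u := by
  constructor
  · intro h
    refine LinearMap.ext fun y => ?_
    have h1 := h.mass_eq y.1 y.1.2
    have h2 := h.momentum_eq y.2.1 y.2.1.2
    have h3 := h.flux_balance y.2.2
    rw [wip_eq_inner] at h2
    simp only [steadyForm, steadyLoad, LinearMap.mk₂_apply, LinearMap.coe_mk, AddHom.coe_mk]
    rw [h1, h2, h3]
    ring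
  · intro h
    have h0 := fun y => LinearMap.congr_fun h y
    simp only [steadyForm, steadyLoad, LinearMap.mk₂_apply, LinearMap.coe_mk, AddHom.coe_mk] at h0
    have hz : ∀ v, N.nsum (0 : N.H1) v = 0 := fun v => by
      simpa using N.nsum_smul 0 0 v
    refine ⟨fun φ hφ => ?_, fun ψ hψ => ?_, fun μ => ?_⟩
    · simpa [hz] using h0 (⟨φ, hφ⟩, 0, 0)
    · simpa [hz, wip_eq_inner] using h0 (0, ⟨ψ, hψ⟩, 0)
    · simpa [hz] using h0 (0, 0, μ)

theorem IsSteadyState.flux_eq {u : N.Port → ℝ} {p : P} {q : Q} {lam : N.Inner → ℝ}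
    (h : N.IsSteadyState P Q u p q lam) : N.flux q = 0 := by
  classical
  funext v
  simpa [flux_apply, Pi.single_apply] using h.flux_balance (Pi.single v 1)

/-- Testing with `∂ₓ' q ∈ P` gives `∂ₓ' q = 0`, and friction then gives `q = 0`. Edgewise constants
detect `lam`, and a `Q`-potential of `p` detects `p`. -/
theorem IsSteadyState.eq_zero (hPQ : N.DerivSurj P Q) (hQ : N.ContainsIndicators Q)
    {p : P} {q : Q} {lam : N.Inner → ℝ} (h : N.IsSteadyState P Q 0 p q lam) :
    (p, q, lam) = 0 := by
  obtain ⟨c₀, c₁, hc₀, -, hc⟩ := N.exists_coeff_bounds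
  have hmom := h.momentum_eq
  simp only [Pi.zero_apply, zero_mul, Finset.sum_const_zero, neg_zero] at hmom
  have hdx : N.dx q = 0 := by
    have h1 := h.mass_eq (N.dx q) (by rw [← hPQ]; exact ⟨q, q.2, rfl⟩)
    exact inner_self_eq_zero.1 h1
  have hq : (q : N.H1) = 0 := by
    have h1 := hmom q q.2
    have h2 : ∀ v : N.Inner, N.nsum q v = 0 := fun v => congrFun h.flux_eq v
    simp only [hdx, h2, inner_zero_right, mul_zero, Finset.sum_const_zero, add_zero, neg_zero,
      zero_add] at h1
    have h3 := N.mul_norm_sq_le_wip (fun e => (hc e).2.2.1) (N.toL2 q)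
    rw [h1] at h3
    have h4 : ‖N.toL2 q‖ ^ 2 = 0 :=
      le_antisymm (nonpos_of_mul_nonpos_right h3 hc₀) (sq_nonneg _)
    exact N.toL2_injective (by rw [map_zero]; exact norm_eq_zero.1 (pow_eq_zero_iff two_ne_zero |>.1 h4))
  have hlam : lam = 0 := by
    refine N.multiplier_eq_zero fun c => ?_
    have h1 := hmom _ (hQ.const_mem c)
    rw [wip_eq_inner, hq, dx_const, inner_zero_right, map_zero, map_zero, inner_zero_left] at h1
    simpa using h1
  obtain ⟨ψ, hψ, hψp⟩ : (p : N.L2) ∈ Q.map N.dx := by rw [hPQ]; exact p.2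
  have h1 := hmom ψ hψ
  rw [wip_eq_inner, hq, hψp, hlam, map_zero, map_zero, inner_zero_left] at h1
  have hp : (p : N.L2) = 0 := by
    rw [← inner_self_eq_zero (𝕜 := ℝ)]
    simpa using h1
  rw [hlam, Submodule.coe_eq_zero.1 hp, Submodule.coe_eq_zero.1 hq]
  rfl

/-- The stationary system maps a finite-dimensional space to its dual, so uniqueness yields
existence. -/
theorem existsUnique_steadyState [FiniteDimensional ℝ P] [FiniteDimensional ℝ Q]
    (hPQ : N.DerivSurj P Q) (hQ : N.ContainsIndicators Q) (u : N.Port → ℝ) :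
    ∃! x : P × Q × (N.Inner → ℝ), N.IsSteadyState P Q u x.1 x.2.1 x.2.2 := by
  have hinj : Function.Injective (steadyForm P Q) := by
    rw [injective_iff_map_eq_zero]
    intro x hx
    refine IsSteadyState.eq_zero hPQ hQ (isSteadyState_iff.2 ?_)
    rw [hx]
    ext <;> simp [steadyLoad]
  have hsurj := surjective_of_injective_of_finrank_dual (X := P × Q × (N.Inner → ℝ))
    (steadyForm P Q) hinj
  obtain ⟨x, hx⟩ := hsurj (steadyLoad P Q u)
  refine ⟨x, isSteadyState_iff.2 hx, fun y hy => hinj ?_⟩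
  rw [hx]
  exact isSteadyState_iff.1 hy

theorem IsSteadyState.weakEquations {u : N.Port → ℝ} {p : P} {q : Q} {lam : N.Inner → ℝ}
    (h : N.IsSteadyState P Q u p q lam) : N.WeakEquations P Q u p q 0 0 := by
  refine ⟨p.2, q.2, h.flux_eq, fun φ hφ => ?_, fun ψ hψ hf => ?_⟩
  · rw [wip_eq_inner, map_zero, inner_zero_left, zero_add]
    exact h.mass_eq φ hφ
  · have h3 := h.momentum_eq ψ hψ
    have h4 : ∀ v : N.Inner, N.nsum ψ v = 0 := fun v => congrFun hf v
    simp only [h4, mul_zero, Finset.sum_const_zero, add_zero] at h3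
    rw [wip_eq_inner, map_zero, inner_zero_left, zero_sub]
    exact h3

theorem WeakEquations.sub {u₁ u₂ : N.Port → ℝ} {p₁ p₂ p₁' p₂' q₁' q₂' : N.L2} {q₁ q₂ : N.H1}
    (h₁ : N.WeakEquations P Q u₁ p₁ q₁ p₁' q₁') (h₂ : N.WeakEquations P Q u₂ p₂ q₂ p₂' q₂') :
    N.WeakEquations P Q (u₁ - u₂) (p₁ - p₂) (q₁ - q₂) (p₁' - p₂') (q₁' - q₂') := by
  refine ⟨P.sub_mem h₁.p_mem h₂.p_mem, Q.sub_mem h₁.q_mem h₂.q_mem, ?_, fun φ hφ => ?_,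
    fun ψ hψ hf => ?_⟩
  · rw [map_sub, h₁.flux_eq, h₂.flux_eq, sub_self]
  · rw [wip_sub_left, map_sub, inner_sub_left]
    linarith [h₁.mass_eq φ hφ, h₂.mass_eq φ hφ]
  · rw [wip_sub_left, map_sub, wip_sub_left, inner_sub_left]
    simp only [Pi.sub_apply, sub_mul, Finset.sum_sub_distrib]
    linarith [h₁.momentum_eq ψ hψ hf, h₂.momentum_eq ψ hψ hf]

/-- By linearity the deviation from a steady state is a weak solution whose input vanishes once `u =
ubar`. -/
theorem IsWeakSolution.sub_const {T : ℝ} {u : ℝ → N.Port → ℝ} {p : ℝ → N.L2} {q : ℝ → N.H1}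
    (h : N.IsWeakSolution P Q T u p q) {ubar : N.Port → ℝ} {pbar : N.L2} {qbar : N.H1}
    (hbar : N.WeakEquations P Q ubar pbar qbar 0 0) :
    N.IsWeakSolution P Q T (fun t => u t - ubar) (fun t => p t - pbar) (fun t => q t - qbar) := by
  refine ⟨h.p_ac.fun_sub contDiffOn_const.absolutelyContinuousOnInterval, ?_, ?_⟩
  · simp only [map_sub]
    exact h.q_ac.fun_sub contDiffOn_const.absolutelyContinuousOnInterval
  · filter_upwards [h.eqs] with t ht hm
    obtain ⟨p', q', hp', hq', heq⟩ := ht hm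
    have h1 := heq.sub hbar
    rw [sub_zero, sub_zero] at h1
    refine ⟨p', q', hp'.sub_const _, ?_, h1⟩
    simp only [map_sub]
    exact hq'.sub_const _

/-! ### Convergence in energy -/

variable (N) in
theorem exists_norm_sq_le_energy : ∃ c : ℝ, 0 < c ∧
    ∀ p q : N.L2, c * (‖p‖ ^ 2 + ‖q‖ ^ 2) ≤ N.energy p q := by
  obtain ⟨c₀, c₁, hc₀, -, hc⟩ := N.exists_coeff_bounds
  refine ⟨c₀ / 2, by positivity, fun p q => ?_⟩
  have h1 := N.mul_norm_sq_le_wip (fun e => (hc e).1.1) p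
  have h2 := N.mul_norm_sq_le_wip (fun e => (hc e).2.1.1) q
  rw [energy]
  linarith

theorem tendsto_zero_of_energy_tendsto_zero {ι : Type*} {l : Filter ι} {p q : ι → N.L2}
    (h : Tendsto (fun i => N.energy (p i) (q i)) l (𝓝 0)) :
    Tendsto p l (𝓝 0) ∧ Tendsto q l (𝓝 0) := by
  obtain ⟨c, hc, hE⟩ := N.exists_norm_sq_le_energy
  have h1 : Tendsto (fun i => √(N.energy (p i) (q i) / c)) l (𝓝 0) := by
    have := (h.div_const c).sqrt
    simpa using this
  have h2 : ∀ i, ‖p i‖ ^ 2 + ‖q i‖ ^ 2 ≤ N.energy (p i) (q i) / c := fun i => by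
    rw [le_div_iff₀ hc, mul_comm]
    exact hE _ _
  exact ⟨squeeze_zero_norm (fun i => Real.le_sqrt_of_sq_le
      (by nlinarith [h2 i, sq_nonneg ‖q i‖])) h1,
    squeeze_zero_norm (fun i => Real.le_sqrt_of_sq_le (by nlinarith [h2 i, sq_nonneg ‖p i‖])) h1⟩

/-- The energy controls only the `L²` norm; finite dimension of `Q` upgrades this to convergence in
`H¹`. -/
theorem tendsto_of_tendsto_toL2 [FiniteDimensional ℝ Q] {ι : Type*} {l : Filter ι} {q : ι → Q}
    {r : Q} (h : Tendsto (fun i => N.toL2 (q i)) l (𝓝 (N.toL2 r))) : Tendsto q l (𝓝 r) := by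
  have h1 : Tendsto (fun i => N.toL2L (q i)) l (𝓝 (N.toL2L r)) := h
  have h2 := @tendsto_of_tendsto_injective N.H1 N.L2 _ _ _ _ Q _ N.toL2L N.toL2_injective ι l q r
  exact h2 h1

end Network

/-! ### Assembly of the result -/

theorem mainTheorem2 {V E : Type*} [Fintype V] [DecidableEq V] [Fintype E] (N : Network V E) :
    ∃ C γ : ℝ, 0 < C ∧ 0 < γ ∧
      N.ContinuousExpStable C γ ∧
      ∀ (Ph PH : Submodule ℝ N.L2) (Qh QH : Submodule ℝ N.H1),
        FiniteDimensional ℝ Ph → FiniteDimensional ℝ Qh → PH ≤ Ph → QH ≤ Qh →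
        N.ContainsOne PH → N.DerivSurj PH QH → N.ContainsIndicators QH →
        N.MassConservation PH QH ∧
        N.EnergyBalance PH QH ∧
        N.ExpStable PH QH C γ ∧
        N.UniqueStableSteadyStates PH QH C γ := by
  obtain ⟨γ, hγ, hdecay⟩ := N.exists_decay
  refine ⟨3, γ, by norm_num, hγ, ?_, ?_⟩
  · intro T hT u p q h t₁ t₂ ht₁ ht₂ hu s t hs hst ht
    exact hdecay ⊤ ⊤ N.derivSurj_top N.containsIndicators_top T u _ q (h.isWeakSolution hT) s t
      (ht₁.trans hs) hst (ht.trans ht₂) fun r hr => hu r ⟨hs.trans hr.1, hr.2.trans ht⟩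
  intro Ph P Qh Q hPh hQh hPPh hQQh hone hPQ hQ
  have : FiniteDimensional ℝ P := Submodule.finiteDimensional_of_le hPPh
  have : FiniteDimensional ℝ Q := Submodule.finiteDimensional_of_le hQQh
  refine ⟨Network.massConservation hone, Network.energyBalance, ?_, ?_⟩
  · intro T hT p₀ q₀ u p q lam h t₁ t₂ ht₁ ht₂ hu s t hs hst ht
    exact hdecay P Q hPQ hQ T u _ _ (h.isWeakSolution hT.le) s t (ht₁.trans hs) hst
      (ht.trans ht₂) fun r hr => hu r ⟨hs.trans hr.1, hr.2.trans ht⟩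
  intro ubar
  obtain ⟨⟨pbar, qbar, lbar⟩, hbar, huniq⟩ := Network.existsUnique_steadyState hPQ hQ ubar
  refine ⟨pbar, qbar, lbar, hbar, fun p q lam h => ?_, ?_⟩
  · simpa [Prod.ext_iff] using huniq (p, q, lam) h
  intro p₀ q₀ u p q lam t₀ ht₀ hu h
  have hE : ∀ s t, t₀ ≤ s → s ≤ t →
      N.energy (p t - pbar : P) (N.toL2 (q t - qbar : Q))
        ≤ 3 * Real.exp (-γ * (t - s)) * N.energy (p s - pbar : P) (N.toL2 (q s - qbar : Q)) := by
    intro s t hs hst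
    -- The horizon `t + 1` is positive even when `t = 0`, as solutions on `[0, T]` are only given
    -- for `T > 0`.
    have ht : 0 < t + 1 := by linarith
    exact hdecay P Q hPQ hQ (t + 1) _ _ _
      (((h (t + 1) ht).isWeakSolution ht.le).sub_const hbar.weakEquations) s t (ht₀.trans hs) hst
      (by linarith) fun r hr => by rw [hu r (hs.trans hr.1), sub_self]
  have hlim : Tendsto (fun t => N.energy (p t - pbar : P) (N.toL2 (q t - qbar : Q))) atTop
      (𝓝 0) := by
    have h1 : Tendsto (fun t => 3 * Real.exp (-γ * (t - t₀))
        * N.energy (p t₀ - pbar : P) (N.toL2 (q t₀ - qbar : Q))) atTop (𝓝 0) := by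
      have h2 : Tendsto (fun t => -γ * (t - t₀)) atTop atBot :=
        (tendsto_id.atTop_add tendsto_const_nhds).const_mul_atTop_of_neg (by linarith)
      have h3 := ((Real.tendsto_exp_atBot.comp h2).const_mul 3).mul_const
        (N.energy (p t₀ - pbar : P) (N.toL2 (q t₀ - qbar : Q)))
      simpa using h3
    refine squeeze_zero' (Eventually.of_forall fun t => ?_) ?_ h1
    · obtain ⟨c, hc, h2⟩ := N.exists_norm_sq_le_energy
      exact (by positivity : (0 : ℝ) ≤ _).trans (h2 _ _)
    · filter_upwards [eventually_ge_atTop t₀] with t ht using hE t₀ t le_rfl ht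
  obtain ⟨hp, hq⟩ := Network.tendsto_zero_of_energy_tendsto_zero hlim
  refine ⟨hE, ?_, ?_⟩
  · rw [tendsto_subtype_rng]
    simpa using hp.add_const (pbar : N.L2)
  · refine Network.tendsto_of_tendsto_toL2 ?_
    simpa using hq.add_const (N.toL2 qbar)
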